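/- **Setting.** Let $\Delta$ be a finite pure 2-dimensional regular cell complex whose underlying space is a surface with boundary, with coordinates $\psi_\sigma:\sigma\hookrightarrow\mathbb R^2$ on each 2-face $\sigma$, coordinate ring $\mathcal R(\sigma)=\mathbb R[u_\sigma,v_\sigma]$, and let $I_\sigma(S)\subseteq\mathcal R(\sigma)$ be the ideal of polynomials vanishing on $\psi_\sigma(S)$. A $G^r$-algebraic transition map from $\sigma$ to $\sigma'$, $\alpha=\sigma\cap\sigma'\neq\emptyset$, is an $\mathbb R$-algebra map $\phi:\mathcal R(\sigma)/I_\sigma(\alpha)^{r+1}\to\mathcal R(\sigma')/I_{\sigma'}(\alpha)^{r+1}$ with $\phi^{-1}(I_{\sigma'}(p))=I_\sigma(p)$ for all $p\in\alpha$. A collection $\Phi$ of such maps is compatible if: its only map from $\sigma$ to itself is the identity; there is at most one map for each ordered pair of 2-faces; whenever $\sigma\cap\sigma'$ is a non-empty face, $\Phi$ contains a map in at least one direction; maps in opposite directions are mutually inverse; and whenever $\sigma_1\cap\sigma_2\cap\sigma_3=\beta$ is a non-empty face and $\phi_{12},\phi_{23}\in\Phi$, there is $\phi_{13}\in\Phi$,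 the three maps induce maps modulo $I_{\sigma_i}(\beta)^{r+1}$, and the induced maps satisfy $\overline{\phi_{23}}\circ\overline{\phi_{12}}=\overline{\phi_{13}}$. Then $(\Delta,\Phi)$ is a $G^r$-domain. For $d\ge 0$, $G^r_d(\Delta,\Phi)$ is the space of tuples $(f_\sigma)$ of polynomials of degree $\le d$ with $\phi(\bar f_\sigma)=\bar f_{\sigma'}$ for every $\phi\in\Phi$ from $\sigma$ to an adjacent $\sigma'$ ($\sigma\cap\sigma'$ an edge). For a vertex or edge $\alpha$ put $\mathcal R(\alpha)=\bigotimes_{\sigma\supseteq\alpha}\mathcal R(\sigma)$ and $\mathcal T_d(\alpha)=\sum_{\sigma\supseteq\alpha}\mathcal R(\sigma)_{\le d}\subseteq\mathcal R(\alpha)$. For an edge $\tau=\sigma_1\cap\sigma_2$ with transition map $\phi_{12}$ lifted by $\tilde\phi_{12}$, let $\mathcal I^r(\tau)=\langle u_1-\tilde\phi_{12}(u_1),v_1-\tilde\phi_{12}(v_1)\rangle+I_{\sigma_1}(\tau)^{r+1}\mathcal R(\tau)+I_{\sigma_2}(\tau)^{r+1}\mathcal R(\tau)$; for a vertex $\gamma$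 let $\mathcal I^r(\gamma)=\sum_{\tau\ni\gamma}\mathcal I^r(\tau)\mathcal R(\gamma)$. Put $\mathcal Q^r_d(\alpha)=\mathcal T_d(\alpha)/(\mathcal T_d(\alpha)\cap\mathcal I^r(\alpha))$ and $\mathcal Q^r_d(\sigma)=\mathcal R(\sigma)_{\le d}$ for 2-faces. With the cellular boundary coefficients relative to $\partial\Delta$ these form a complex $$\mathcal Q^r_{d,\bullet}:\ \bigoplus_{\sigma}\mathcal Q^r_d(\sigma)\to\bigoplus_{\tau\text{ interior edge}}\mathcal Q^r_d(\tau)\to\bigoplus_{\gamma\text{ interior vertex}}\mathcal Q^r_d(\gamma),$$ and $\chi(\mathcal Q^r_{d,\bullet})=\sum_\sigma\dim\mathcal Q^r_d(\sigma)-\sum_\tau\dim\mathcal Q^r_d(\tau)+\sum_\gamma\dim\mathcal Q^r_d(\gamma)$. Replacing "degree $\le d$" by "degree $\le d$ in each variable" gives the bidegree versions $G^r_{(d,d)}$, $\mathcal Q^r_{(d,d),\bullet}$. Let $(\Delta_\gamma,\Phi)$ be a $G^r$-domain that is the star of an interior vertex $\gamma$: its 2-faces are $\sigma_1,\dots,\sigma_s$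 (indices mod $s$, $s\ge 3$), $\sigma_t\cap\sigma_{t+1}=\tau_t\ni\gamma$ are distinct edges, each $\tau_t$ lies in no further 2-face, the $\tau_t$ are exactly the interior edges and $\gamma$ is the only interior vertex. **Theorem.** 1. For all $r,d\ge 0$, $\dim G^r_d(\Delta_\gamma,\Phi)=\chi(\mathcal Q^r_{d,\bullet})+\dim H_1(\mathcal Q^r_{d,\bullet})$; in particular $\chi(\mathcal Q^r_{d,\bullet})\le\dim G^r_d(\Delta_\gamma,\Phi)$. The same holds with $d$ replaced by $(d,d)$. Now let $r=1$ and let $\Phi$ be given by symmetric gluing data: writing $(u_t,v_t)$ for the coordinates on $\sigma_t$, $\gamma$ is the origin, $I_{\sigma_t}(\tau_t)=\langle u_t\rangle$, $I_{\sigma_{t+1}}(\tau_t)=\langle v_{t+1}\rangle$, the second vertex $\gamma_t'$ of $\tau_t$ is $(u_{t+1},v_{t+1})=(1,0)$, and the transition map from $\sigma_t$ to $\sigma_{t+1}$ is $$u_t\mapsto -v_{t+1},\quad v_t\mapsto u_{t+1}+v_{t+1}\mathfrak a_t(u_{t+1}),\quad \mathfrak a_t(u)=2\cos\tfrac{2\pi}{s}\,h(u)-2\cos\tfrac{2\pi}{w'_t}\,q(u),$$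 where $w'_t\ge1$ is the valence of $\gamma'_t$ (in a complex of which $\Delta_\gamma$ is the star of $\gamma$) and $h,q$ are polynomials with $h(0)=1,h(1)=0,q(0)=0,q(1)=1$. 2. If $s\ne4$ and all $\mathfrak a_t$ have the same degree $d_{\mathfrak a}\ge1$, then $\chi(\mathcal Q^1_{d,\bullet})=s\binom{d+2}{2}-s(2d+d_{\mathfrak a}+1)+3$ for $d\ge d_{\mathfrak a}+1$, and $\chi(\mathcal Q^1_{(d,d),\bullet})=s(d+1)^2-s(2d+d_{\mathfrak a}+1)+3$ for $d\ge d_{\mathfrak a}$. 3. For the standard choice $h(u)=(1-u)^2$, $q(u)=u^2$: * $\dim G^1_d(\Delta_\gamma,\Phi)=\chi(\mathcal Q^1_{d,\bullet})$ for $d\ge4$, and $\dim G^1_{(d,d)}(\Delta_\gamma,\Phi)=\chi(\mathcal Q^1_{(d,d),\bullet})$ for $d\ge3$; * if $s\neq4$, then every $\mathfrak a_t$ has degree $\ge1$ (so that 2. applies when the degrees are equal); * if $s=4$ and all $\mathfrak a_t\ne0$: $\chi(\mathcal Q^1_{d,\bullet})=2(d^2-d-2)$ for $d\ge2$ and $\chi(\mathcal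 Q^1_{(d,d),\bullet})=4(d^2-1)$ for $d\ge1$; * if $s=4$ and all $\mathfrak a_t=0$: $\chi(\mathcal Q^1_{d,\bullet})=2(d^2-d+2)$ for $d\ge2$ and $\chi(\mathcal Q^1_{(d,d),\bullet})=4d^2$ for $d\ge1$. -/

import Mathlib

open Topology

noncomputable section

namespace GrSpline

section Cells

variable {X : Type*} [TopologicalSpace X] [CWComplex (Set.univ : Set X)]

variable (X) in
/-- The `0`-faces of the cell complex `X`. -/
abbrev Vertex : Type _ := RelCWComplex.cell (Set.univ : Set X) 0

variable (X) in
/-- The `1`-faces of the cell complex `X`. -/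
abbrev Edge : Type _ := RelCWComplex.cell (Set.univ : Set X) 1

variable (X) in
/-- The `2`-faces of the cell complex `X`. -/
abbrev Face : Type _ := RelCWComplex.cell (Set.univ : Set X) 2

/-- The closed cell of a vertex (a one-point set). -/
def vert (v : Vertex X) : Set X := RelCWComplex.closedCell (C := Set.univ) 0 v

/-- The closed cell of an edge; it contains its end points. -/
def edge (e : Edge X) : Set X := RelCWComplex.closedCell (C := Set.univ) 1 e

/-- The closed cell of a 2-face; it contains its edges and vertices. -/
def face (σ : Face X) : Set X := RelCWComplex.closedCell (C := Set.univ) 2 σ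

variable (X) in
/-- `X` is a surface with boundary, and its cell structure is 2-dimensional, pure and regular. -/
structure IsSurfaceComplex : Prop where
  t2 : T2Space X
  secondCountable : SecondCountableTopology X
  /-- every point has a neighbourhood homeomorphic to an open subset of a closed half-plane -/
  manifold : Nonempty (ChartedSpace (EuclideanHalfSpace 2) X)
  dim_le : ∀ n, 2 < n → IsEmpty (RelCWComplex.cell (Set.univ : Set X) n)
  pure : ∀ n (c : RelCWComplex.cell (Set.univ : Set X) n),
    ∃ σ : Face X, RelCWComplex.closedCell n c ⊆ face σ
  /-- closed cells are embedded closed balls -/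
  regular : ∀ n (c : RelCWComplex.cell (Set.univ : Set X) n),
    Set.InjOn (RelCWComplex.map n c) (Metric.closedBall 0 1)

/-- The set `S` is a (closed) face of the complex. -/
def IsCell (S : Set X) : Prop :=
  ∃ (n : ℕ) (c : RelCWComplex.cell (Set.univ : Set X) n), S = RelCWComplex.closedCell n c

/-- An edge is interior if it is shared by two 2-faces, i.e. not contained in the boundary. -/
def IsInteriorEdge (e : Edge X) : Prop :=
  ∃ σ σ' : Face X, σ ≠ σ' ∧ edge e ⊆ face σ ∧ edge e ⊆ face σ'

/-- A vertex is interior if it does not lie on a boundary edge. -/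
def IsInteriorVertex (v : Vertex X) : Prop :=
  ∀ e : Edge X, vert v ⊆ edge e → IsInteriorEdge e

variable (X) in
/-- The interior edges. -/
abbrev InteriorEdge : Type _ := {e : Edge X // IsInteriorEdge e}

variable (X) in
/-- The interior vertices. -/
abbrev InteriorVertex : Type _ := {v : Vertex X // IsInteriorVertex v}

variable (X) in
/-- A choice of orientations of the cells, through its incidence numbers: for a regular cell
complex these axioms characterise the matrices of the cellular boundary maps. -/
structure CellOrientation [Fintype (Vertex X)] [Fintype (Edge X)] where
  faceEdge : Face X → Edge X → ℤ
  edgeVert : Edge X → Vertex X → ℤ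
  faceEdge_of_subset : ∀ σ e, edge e ⊆ face σ → faceEdge σ e = 1 ∨ faceEdge σ e = -1
  faceEdge_of_not_subset : ∀ σ e, ¬ edge e ⊆ face σ → faceEdge σ e = 0
  edgeVert_of_subset : ∀ e v, vert v ⊆ edge e → edgeVert e v = 1 ∨ edgeVert e v = -1
  edgeVert_of_not_subset : ∀ e v, ¬ vert v ⊆ edge e → edgeVert e v = 0
  sum_edgeVert : ∀ e, ∑ v, edgeVert e v = 0
  sum_faceEdge_mul_edgeVert : ∀ σ v, ∑ e, faceEdge σ e * edgeVert e v = 0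

end Cells

/-- The coordinate ring of a 2-face: real polynomials in the coordinates `(u, v)`,
with `u = X 0` and `v = X 1`. -/
abbrev Poly : Type := MvPolynomial (Fin 2) ℝ

section Domain

variable {X : Type*} [TopologicalSpace X] [CWComplex (Set.univ : Set X)]

/-- Coordinates on the 2-faces: `ψ σ` restricts to a homeomorphism of `face σ` onto its image. -/
def IsCoordinates (ψ : Face X → X → Fin 2 → ℝ) : Prop :=
  ∀ σ, IsEmbedding ((face σ).domRestrict (ψ σ))

/-- `I_σ(S)`: the polynomials on `σ` that vanish at the points of `S`. -/
def idealOf (ψ : Face X → X → Fin 2 → ℝ) (σ : Face X) (S : Set X) : Ideal Poly :=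
  MvPolynomial.vanishingIdeal ℝ (ψ σ '' S)

/-- `R(σ) / I_σ(S)^(r+1)`. -/
abbrev JetRing (ψ : Face X → X → Fin 2 → ℝ) (r : ℕ) (S : Set X) (σ : Face X) : Type :=
  Poly ⧸ (idealOf ψ σ S) ^ (r + 1)

/-- Algebra homomorphisms `R(σ) / I_σ(S)^(r+1) → R(σ') / I_σ'(S)^(r+1)`. -/
abbrev JetHom (ψ : Face X → X → Fin 2 → ℝ) (r : ℕ) (S : Set X) (σ σ' : Face X) : Type :=
  JetRing ψ r S σ →ₐ[ℝ] JetRing ψ r S σ'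

variable {ψ : Face X → X → Fin 2 → ℝ} {r : ℕ}

/-- `f` and `g` join with `G^r`-continuity with respect to `φ`: `φ` maps the class of `f` to
the class of `g`. -/
def Joins {S : Set X} {σ σ' : Face X} (φ : JetHom ψ r S σ σ') (f g : Poly) : Prop :=
  φ (Ideal.Quotient.mk _ f) = Ideal.Quotient.mk _ g

/-- `φ` is a `G^r`-algebraic transition map along `S`: the preimage of (the image of) the ideal of
each point `p` of `S` is (the image of) the ideal of `p`. -/
def IsTransitionMap {S : Set X} {σ σ' : Face X} (φ : JetHom ψ r S σ σ') : Prop :=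
  ∀ p ∈ S,
    ((idealOf ψ σ' {p}).map (Ideal.Quotient.mk ((idealOf ψ σ' S) ^ (r + 1)))).comap φ =
      (idealOf ψ σ {p}).map (Ideal.Quotient.mk ((idealOf ψ σ S) ^ (r + 1)))

/-- `φ'` is induced by `φ` on the quotients that belong to a smaller set `S'`. -/
def IsRestriction {S S' : Set X} {σ σ' : Face X} (φ : JetHom ψ r S σ σ')
    (φ' : JetHom ψ r S' σ σ') : Prop :=
  ∀ f g, Joins φ f g → Joins φ' f g

variable (ψ r) in
/-- Collections of maps: `Φ σ σ'` is the set of the members of the collection from `σ` to `σ'`. -/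
abbrev Transitions : Type _ :=
  ∀ σ σ' : Face X, Set (JetHom ψ r (face σ ∩ face σ') σ σ')

/-- A compatible collection of `G^r`-algebraic transition maps. -/
structure IsCompatible (Φ : Transitions ψ r) : Prop where
  isTransitionMap : ∀ σ σ', ∀ φ ∈ Φ σ σ', (face σ ∩ face σ').Nonempty ∧ IsTransitionMap φ
  refl : ∀ σ, Φ σ σ = {AlgHom.id ℝ _}
  exists_map : ∀ σ σ', IsCell (face σ ∩ face σ') → (Φ σ σ').Nonempty ∨ (Φ σ' σ).Nonempty
  /-- two members in opposite directions are inverse to each other -/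
  inverse : ∀ σ σ', ∀ φ ∈ Φ σ σ', ∀ φ' ∈ Φ σ' σ, ∀ f g, Joins φ f g ↔ Joins φ' g f
  unique : ∀ σ σ', (Φ σ σ').Subsingleton
  comp : ∀ σ₁ σ₂ σ₃, IsCell (face σ₁ ∩ face σ₂ ∩ face σ₃) →
    ∀ φ₁₂ ∈ Φ σ₁ σ₂, ∀ φ₂₃ ∈ Φ σ₂ σ₃, ∃ φ₁₃ ∈ Φ σ₁ σ₃,
      ∃ (θ₁₂ : JetHom ψ r (face σ₁ ∩ face σ₂ ∩ face σ₃) σ₁ σ₂)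
        (θ₂₃ : JetHom ψ r (face σ₁ ∩ face σ₂ ∩ face σ₃) σ₂ σ₃)
        (θ₁₃ : JetHom ψ r (face σ₁ ∩ face σ₂ ∩ face σ₃) σ₁ σ₃),
        IsRestriction φ₁₂ θ₁₂ ∧ IsRestriction φ₂₃ θ₂₃ ∧ IsRestriction φ₁₃ θ₁₃ ∧
          θ₂₃.comp θ₁₂ = θ₁₃

/-- `(X, Φ)`, with the coordinates `ψ`, is a (2-dimensional) `G^r`-domain. -/
structure IsGrDomain (Φ : Transitions ψ r) : Prop where
  isSurfaceComplex : IsSurfaceComplex X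
  isCoordinates : IsCoordinates ψ
  isCompatible : IsCompatible Φ

/-- The space of `G^r`-splines whose pieces belong to the space `W` of polynomials. -/
def splines (Φ : Transitions ψ r) (W : Submodule ℝ Poly) : Submodule ℝ (Face X → Poly) where
  carrier := {f | (∀ σ, f σ ∈ W) ∧ ∀ (σ σ' : Face X) (e : Edge X), σ ≠ σ' →
    face σ ∩ face σ' = edge e → ∀ φ ∈ Φ σ σ', Joins φ (f σ) (f σ')}
  add_mem' := by
    rintro f g ⟨hf, hf'⟩ ⟨hg, hg'⟩
    refine ⟨fun σ => W.add_mem (hf σ) (hg σ), fun σ σ' e h he φ hφ => ?_⟩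
    have h1 := hf' σ σ' e h he φ hφ
    have h2 := hg' σ σ' e h he φ hφ
    simp only [Joins, Pi.add_apply, map_add] at h1 h2 ⊢
    rw [h1, h2]
  zero_mem' := ⟨fun σ => W.zero_mem, fun σ σ' e h he φ hφ => by simp [Joins]⟩
  smul_mem' := by
    rintro c f ⟨hf, hf'⟩
    refine ⟨fun σ => W.smul_mem c (hf σ), fun σ σ' e h he φ hφ => ?_⟩
    have h1 := hf' σ σ' e h he φ hφ
    simp only [Joins, Pi.smul_apply] at h1 ⊢
    have key : ∀ (I : Ideal Poly) (p : Poly),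
        Ideal.Quotient.mk I (c • p) = c • Ideal.Quotient.mk I p := fun I p => rfl
    rw [key, key, map_smul, h1]

end Domain

section Complex

variable {X : Type*} [TopologicalSpace X] [CWComplex (Set.univ : Set X)]

/-- The 2-faces that contain `S`. -/
abbrev FacesAt (S : Set X) : Type _ := {σ : Face X // S ⊆ face σ}

/-- `R(S)`: the tensor product of the coordinate rings of the 2-faces that contain `S`, i.e. the
polynomial ring in all the coordinates of these faces. -/
abbrev RingAt (S : Set X) : Type _ := MvPolynomial (FacesAt S × Fin 2) ℝ

/-- The inclusion `R(σ) → R(S)` for `S ⊆ σ`. -/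
def incl {S : Set X} {σ : Face X} (h : S ⊆ face σ) : Poly →ₐ[ℝ] RingAt S :=
  MvPolynomial.rename fun i => (⟨σ, h⟩, i)

/-- The inclusion `R(S) → R(S')` for `S' ⊆ S`. -/
def res {S S' : Set X} (h : S' ⊆ S) : RingAt S →ₐ[ℝ] RingAt S' :=
  MvPolynomial.rename fun x => (⟨x.1.1, h.trans x.1.2⟩, x.2)

/-- `T(S)`: the sums of polynomials in `W` on the 2-faces that contain `S` (no mixed terms). -/
def sumSpace (W : Submodule ℝ Poly) (S : Set X) : Submodule ℝ (RingAt S) :=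
  ⨆ σ : FacesAt S, W.map (incl σ.2).toLinearMap

/-- `J = T(S) ∩ I`, as a subspace of `T(S)`. -/
def sumIdeal (W : Submodule ℝ Poly) {S : Set X} (I : Ideal (RingAt S)) :
    Submodule ℝ (sumSpace W S) :=
  (I.restrictScalars ℝ).submoduleOf (sumSpace W S)

/-- `Q = T(S) / J`. -/
def QSpace (W : Submodule ℝ Poly) {S : Set X} (I : Ideal (RingAt S)) : Type _ :=
  sumSpace W S ⧸ sumIdeal W I

instance (W : Submodule ℝ Poly) {S : Set X} (I : Ideal (RingAt S)) : AddCommGroup (QSpace W I) :=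
  inferInstanceAs (AddCommGroup (sumSpace W S ⧸ sumIdeal W I))

instance (W : Submodule ℝ Poly) {S : Set X} (I : Ideal (RingAt S)) : Module ℝ (QSpace W I) :=
  inferInstanceAs (Module ℝ (sumSpace W S ⧸ sumIdeal W I))

theorem incl_mem (W : Submodule ℝ Poly) {S : Set X} {σ : Face X} (h : S ⊆ face σ) :
    ∀ f ∈ W, (incl h).toLinearMap f ∈ sumSpace W S := fun f hf =>
  (le_iSup (fun σ : FacesAt S => W.map (incl σ.2).toLinearMap) ⟨σ, h⟩) ⟨f, hf, rfl⟩

theorem res_incl {S S' : Set X} (h : S' ⊆ S) {σ : Face X} (hσ : S ⊆ face σ) (f : Poly) :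
    res h (incl hσ f) = incl (h.trans hσ) f := by
  simp only [res, incl, MvPolynomial.rename_rename]
  rfl

theorem res_mem (W : Submodule ℝ Poly) {S S' : Set X} (h : S' ⊆ S) :
    ∀ f ∈ sumSpace W S, (res h).toLinearMap f ∈ sumSpace W S' := by
  have : sumSpace W S ≤ (sumSpace W S').comap (res h).toLinearMap := by
    refine iSup_le fun σ => ?_
    rintro _ ⟨f, hf, rfl⟩
    change res h (incl σ.2 f) ∈ sumSpace W S'
    rw [res_incl]
    exact incl_mem W (h.trans σ.2) f hf
  exact this

/-- The map `R(σ) ⊇ W → Q(S)` for `S ⊆ σ`. -/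
def faceMap (W : Submodule ℝ Poly) {S : Set X} (I : Ideal (RingAt S)) {σ : Face X}
    (h : S ⊆ face σ) : W →ₗ[ℝ] QSpace W I :=
  (sumIdeal W I).mkQ ∘ₗ (incl h).toLinearMap.restrict (incl_mem W h)

/-- The map `Q(S) → Q(S')` induced by `R(S) → R(S')`, for `S' ⊆ S`. -/
def quotMap (W : Submodule ℝ Poly) {S S' : Set X} (h : S' ⊆ S) (I : Ideal (RingAt S))
    (I' : Ideal (RingAt S')) (hI : I.map (res h) ≤ I') : QSpace W I →ₗ[ℝ] QSpace W I' :=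
  (sumIdeal W I).mapQ (sumIdeal W I') ((res h).toLinearMap.restrict (res_mem W h))
    fun _ hx => hI (Ideal.mem_map_of_mem (res h) hx)

theorem quotMap_faceMap (W : Submodule ℝ Poly) {S S' : Set X} (h : S' ⊆ S) (I : Ideal (RingAt S))
    (I' : Ideal (RingAt S')) (hI : I.map (res h) ≤ I') {σ : Face X} (hσ : S ⊆ face σ) (f : W) :
    quotMap W h I I' hI (faceMap W I hσ f) = faceMap W I' (h.trans hσ) f := by
  change (sumIdeal W I').mkQ _ = (sumIdeal W I').mkQ _
  congr 1
  exact Subtype.ext (res_incl h hσ f)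

variable {ψ : Face X → X → Fin 2 → ℝ} {r : ℕ}

/-- The ideal of `R(S)`, `S ⊆ σ₁ ∩ σ₂`, generated by the differences `x - φ(x)` for the coordinates
`x` of `σ₁` (with all the lifts of `φ(x)`), by `I_σ₁(S)^(r+1)` and by `I_σ₂(S)^(r+1)`. -/
def gluingIdeal {S : Set X} {σ₁ σ₂ : Face X} (h₁ : S ⊆ face σ₁) (h₂ : S ⊆ face σ₂)
    (φ : JetHom ψ r (face σ₁ ∩ face σ₂) σ₁ σ₂) : Ideal (RingAt S) :=
  Ideal.span {y | ∃ (i : Fin 2) (g : Poly), Joins φ (MvPolynomial.X i) g ∧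
      y = incl h₁ (MvPolynomial.X i) - incl h₂ g} ⊔
    ((idealOf ψ σ₁ S) ^ (r + 1)).map (incl h₁) ⊔ ((idealOf ψ σ₂ S) ^ (r + 1)).map (incl h₂)

/-- `I^r(τ)` for an edge `τ = σ₁ ∩ σ₂`. (If both `φ₁₂` and `φ₂₁` are members of `Φ`, they are
inverse to each other and give the same ideal.) -/
def edgeIdeal (Φ : Transitions ψ r) (e : Edge X) : Ideal (RingAt (edge e)) :=
  ⨆ (σ₁ : Face X) (σ₂ : Face X) (_ : σ₁ ≠ σ₂) (h : edge e = face σ₁ ∩ face σ₂)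
    (φ : JetHom ψ r (face σ₁ ∩ face σ₂) σ₁ σ₂) (_ : φ ∈ Φ σ₁ σ₂),
    gluingIdeal (h.subset.trans Set.inter_subset_left) (h.subset.trans Set.inter_subset_right) φ

/-- `I^r(γ)` for a vertex `γ`: the sum of the extensions of `I^r(τ)` for the edges `τ ∋ γ`. -/
def vertIdeal (Φ : Transitions ψ r) (v : Vertex X) : Ideal (RingAt (vert v)) :=
  ⨆ (e : Edge X) (h : vert v ⊆ edge e), (edgeIdeal Φ e).map (res h)

theorem map_edgeIdeal_le (Φ : Transitions ψ r) {e : Edge X} {v : Vertex X}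
    (h : vert v ⊆ edge e) : (edgeIdeal Φ e).map (res h) ≤ vertIdeal Φ v :=
  le_iSup₂ (f := fun (e : Edge X) (h : vert v ⊆ edge e) => (edgeIdeal Φ e).map (res h)) e h

/-- The 2-chains of the complex `Q`. -/
abbrev Chain₂ (X : Type*) [TopologicalSpace X] [CWComplex (Set.univ : Set X)]
    (W : Submodule ℝ Poly) : Type _ := Face X → W

/-- The 1-chains of the complex `Q`, relative to the boundary. -/
abbrev Chain₁ (Φ : Transitions ψ r) (W : Submodule ℝ Poly) : Type _ :=
  ∀ e : InteriorEdge X, QSpace W (edgeIdeal Φ e.1)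

/-- The 0-chains of the complex `Q`, relative to the boundary. -/
abbrev Chain₀ (Φ : Transitions ψ r) (W : Submodule ℝ Poly) : Type _ :=
  ∀ v : InteriorVertex X, QSpace W (vertIdeal Φ v.1)

variable [Fintype (Vertex X)] [Fintype (Edge X)] [Fintype (Face X)]

open Classical in
/-- The differential from 2-chains to 1-chains. -/
def δ₂ (o : CellOrientation X) (Φ : Transitions ψ r) (W : Submodule ℝ Poly) :
    Chain₂ X W →ₗ[ℝ] Chain₁ Φ W :=
  LinearMap.pi fun e => ∑ σ : Face X,
    if h : edge e.1 ⊆ face σ then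
      o.faceEdge σ e.1 • (faceMap W (edgeIdeal Φ e.1) h ∘ₗ LinearMap.proj σ)
    else 0

open Classical in
/-- The differential from 1-chains to 0-chains. -/
def δ₁ (o : CellOrientation X) (Φ : Transitions ψ r) (W : Submodule ℝ Poly) :
    Chain₁ Φ W →ₗ[ℝ] Chain₀ Φ W :=
  LinearMap.pi fun v => ∑ e : InteriorEdge X,
    if h : vert v.1 ⊆ edge e.1 then
      o.edgeVert e.1 v.1 •
        (quotMap W h (edgeIdeal Φ e.1) (vertIdeal Φ v.1) (map_edgeIdeal_le Φ h) ∘ₗ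
          LinearMap.proj e)
    else 0

theorem δ₁_comp_δ₂ (o : CellOrientation X) (Φ : Transitions ψ r) (W : Submodule ℝ Poly) :
    δ₁ o Φ W ∘ₗ δ₂ o Φ W = 0 := by
  classical
  ext1 σ
  ext1 f
  funext v
  have hterm : ∀ e : InteriorEdge X, (if h : vert v.1 ⊆ edge e.1 then
      o.edgeVert e.1 v.1 •
        (quotMap W h (edgeIdeal Φ e.1) (vertIdeal Φ v.1) (map_edgeIdeal_le Φ h) ∘ₗ
          LinearMap.proj (φ := fun e : InteriorEdge X => QSpace W (edgeIdeal Φ e.1)) e)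
      else 0) (δ₂ o Φ W (Pi.single σ f)) =
      (o.faceEdge σ e.1 * o.edgeVert e.1 v.1) •
        (if h : vert v.1 ⊆ face σ then faceMap W (vertIdeal Φ v.1) h f else 0) := by
    intro e
    have h2 : δ₂ o Φ W (Pi.single σ f) e =
        if h : edge e.1 ⊆ face σ then o.faceEdge σ e.1 • faceMap W (edgeIdeal Φ e.1) h f
        else 0 := by
      simp only [δ₂, LinearMap.pi_apply, LinearMap.sum_apply]
      rw [Finset.sum_eq_single σ]
      · split_ifs <;> simp
      · intro σ' _ hne
        split_ifs <;> simp [Pi.single_eq_of_ne hne]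
      · simp
    by_cases h : vert v.1 ⊆ edge e.1
    · rw [dif_pos h, LinearMap.smul_apply, LinearMap.comp_apply, LinearMap.proj_apply, h2]
      by_cases h' : edge e.1 ⊆ face σ
      · rw [dif_pos h', dif_pos (h.trans h'), map_zsmul, quotMap_faceMap, smul_smul, mul_comm]
      · rw [dif_neg h', o.faceEdge_of_not_subset _ _ h']
        simp
    · rw [dif_neg h, o.edgeVert_of_not_subset _ _ h]
      simp
  have hsum : ∑ e : InteriorEdge X, o.faceEdge σ e.1 * o.edgeVert e.1 v.1 = 0 := by
    rw [← o.sum_faceEdge_mul_edgeVert σ v.1]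
    refine Finset.sum_bij_ne_zero (fun e _ _ => e.1) (by simp)
      (fun a _ _ b _ _ hab => Subtype.ext hab) ?_ (by simp)
    intro e _ he
    have hve : vert v.1 ⊆ edge e := by
      by_contra hc
      exact he (by rw [o.edgeVert_of_not_subset _ _ hc, mul_zero])
    exact ⟨⟨e, v.2 e hve⟩, Finset.mem_univ _, he, rfl⟩
  change δ₁ o Φ W (δ₂ o Φ W (Pi.single σ f)) v = 0
  rw [δ₁, LinearMap.pi_apply, LinearMap.sum_apply, Finset.sum_congr rfl fun e _ => hterm e,
    ← Finset.sum_smul, hsum, zero_smul]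

/-- `H₁(Q) = ker δ₁ / im δ₂`. -/
abbrev H₁ (o : CellOrientation X) (Φ : Transitions ψ r) (W : Submodule ℝ Poly) : Type _ :=
  LinearMap.ker (δ₁ o Φ W) ⧸ (LinearMap.range (δ₂ o Φ W)).submoduleOf (LinearMap.ker (δ₁ o Φ W))

open Classical in
/-- The Euler characteristic of the complex `Q`. -/
def eulerChar (Φ : Transitions ψ r) (W : Submodule ℝ Poly) : ℤ :=
  (∑ _σ : Face X, (Module.finrank ℝ W : ℤ))
    - (∑ e : InteriorEdge X, (Module.finrank ℝ (QSpace W (edgeIdeal Φ e.1)) : ℤ))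
    + ∑ v : InteriorVertex X, (Module.finrank ℝ (QSpace W (vertIdeal Φ v.1)) : ℤ)

end Complex

/-- The polynomials of total degree at most `d`. -/
abbrev totalDeg (d : ℕ) : Submodule ℝ Poly := MvPolynomial.restrictTotalDegree (Fin 2) ℝ d

/-- The polynomials of bidegree at most `(d, d)`. -/
abbrev biDeg (d : ℕ) : Submodule ℝ Poly := MvPolynomial.restrictDegree (Fin 2) ℝ d

section Star

variable {X : Type*} [TopologicalSpace X] [CWComplex (Set.univ : Set X)]

/-- The complex is the star of the interior vertex `γ`: its 2-faces are `σ t`, cyclically indexed,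
all of them contain `γ`, consecutive ones meet in the edge `τ t ∋ γ`, the `τ t` are the
interior edges, and `γ` is the only interior vertex. -/
structure IsVertexStar (γ : Vertex X) {s : ℕ} (σ : ZMod s → Face X) (τ : ZMod s → Edge X) :
    Prop where
  three_le : 3 ≤ s
  bijective : Function.Bijective σ
  injective : Function.Injective τ
  mem : ∀ t, vert γ ⊆ edge (τ t)
  inter : ∀ t, face (σ t) ∩ face (σ (t + 1)) = edge (τ t)
  only : ∀ t t', edge (τ t) ⊆ face (σ t') → t' = t ∨ t' = t + 1
  isInteriorEdge_iff : ∀ e, IsInteriorEdge e ↔ e ∈ Set.range τ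
  isInteriorVertex_iff : ∀ v, IsInteriorVertex v ↔ v = γ

variable {ψ : Face X → X → Fin 2 → ℝ} {r : ℕ}

/-- The transition map from `σ t` to `σ (t+1)` is given by the gluing data `[a t, b t]`, i.e.
`u_t ↦ v_{t+1} b(u_{t+1})` and `v_t ↦ u_{t+1} + v_{t+1} a(u_{t+1})`, in coordinates where the edge
`τ t` lies on `u_t = 0` and on `v_{t+1} = 0`, the vertex `γ` is the origin, and the other vertex of
`τ t` is `(u_{t+1}, v_{t+1}) = (1, 0)`. -/
structure IsGluedBy (Φ : Transitions ψ r) (γ : Vertex X) {s : ℕ} (σ : ZMod s → Face X)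
    (τ : ZMod s → Edge X) (a b : ZMod s → Polynomial ℝ) : Prop where
  ideal_left : ∀ t, idealOf ψ (σ t) (edge (τ t)) = Ideal.span {MvPolynomial.X 0}
  ideal_right : ∀ t, idealOf ψ (σ (t + 1)) (edge (τ t)) = Ideal.span {MvPolynomial.X 1}
  origin : ∀ t, ∀ p ∈ vert γ, ψ (σ t) p = ![0, 0]
  endpoint : ∀ t, ∃ v : Vertex X, v ≠ γ ∧ vert v ⊆ edge (τ t) ∧
    ∀ p ∈ vert v, ψ (σ (t + 1)) p = ![1, 0]
  map : ∀ t, ∃ φ ∈ Φ (σ t) (σ (t + 1)),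
    Joins φ (MvPolynomial.X 0)
      (MvPolynomial.X 1 * Polynomial.aeval (MvPolynomial.X 0 : Poly) (b t)) ∧
    Joins φ (MvPolynomial.X 1)
      (MvPolynomial.X 0 + MvPolynomial.X 1 * Polynomial.aeval (MvPolynomial.X 0 : Poly) (a t))

end Star

/-- The polynomial `2 cos(2π/w) h - 2 cos(2π/w') q`. -/
def symGluing (w w' : ℕ) (h q : Polynomial ℝ) : Polynomial ℝ :=
  Polynomial.C (2 * Real.cos (2 * Real.pi / w)) * h
    - Polynomial.C (2 * Real.cos (2 * Real.pi / w')) * q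

end GrSpline

end

/-!
Let `W` be a space of polynomials, and let the 2-faces of the star be `σ_t`, `t` modulo `s`.

**Splines and the Euler characteristic.** The ideal of an edge `τ = σ₁ ∩ σ₂` is the kernel of the
map `R(τ) → R(σ₂) / I_σ₂(τ)^(r+1)` given by the transition map on `R(σ₁)` (`exists_edgeHom`).
Hence `f` and `g` have the same class in `Q(τ)` exactly if they join
(`faceMap_eq_iff_joins`). The incidence numbers need not come from a coherent orientation of
the faces, but the coefficient of `γ` in `∂∂σ_t` shows that after multiplying the member on `σ_t` by
a sign, the component of `δ₂ f` at `τ_t` is `±(f_t - f_{t+1})` (`δ₂_starTwist`); so the kernel of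
`δ₂` is isomorphic to the space of splines (`finrank_splines`). Every face meets an interior edge at
`γ`, so `δ₁` is surjective (`δ₁_surjective`), and counting dimensions gives
`dim G = χ + dim H₁` (`finrank_splines_eq_add`). The same count shows that `H₁` vanishes if the
cokernel of `δ₂` is not larger than `Q(γ)` (`finrank_splines_eq_eulerChar`).

**Edges for `r = 1`.** Here `R(σ_{t+1}) / ⟨v⟩²` embeds in `ℝ[X][ε]`, and `Q(τ_t)` becomes the space
of pairs `p + ε q` with `deg p ≤ d` and `q ∈ ℝ[X]_{<n} + a_t ℝ[X]_{<d}`, with `n = d` for total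
degree and `n = d + 1` for bidegree (`map_jetLeft_sup_map_jetRight`). Division by `a_t` gives its
dimension.

**The vertex for `r = 1`.** Consider linear maps `F_t` from polynomials to one space such that
`F_t f = F_{t+1} g` whenever `f` and `g` join across `τ_t`. They vanish on the multiples of `u²` and
of `v²`, and carrying `u`, `v`, `uv` and `v²` across the edges yields, with `c = 2 cos (2π/s)`,
`U_t = -V_{t+1}`, `P_t = -P_{t+1}`, `V_{t+2} = c V_{t+1} - V_t + a_t'(0) P_{t+1}` and `c P_t = 0`
for the images `U_t`, `V_t`, `P_t` of `u`, `v`, `uv`. So the images span a space of dimension at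
most four, and at most three if `c ≠ 0`, that is, if `s ≠ 4` (`exists_finrank_le`). This applies
both to `R(γ) / I(γ)` and to the cokernel of `δ₂`; in the second case `W` has to contain the
polynomials that are used, which for the standard data is the condition `d ≥ 4`, respectively
`d ≥ 3`. Conversely `Q(γ)` has these dimensions (`le_finrank_vertex`): if `s ≠ 4`, send `v_t` to `ε`
times the `t`-th power of a primitive `s`-th root of unity in the square-zero extension of `ℝ` by
`ℂ`; if `s = 4`, send the `v_t` to `x, y, -x, -y` in `ℝ[x, y] / (x², y²)`.
-/

noncomputable section

namespace GrSpline

/-! ### The spaces `Q(S)` -/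

section QSpaceLemmas

variable {X : Type*} [TopologicalSpace X] [CWComplex (Set.univ : Set X)]

/-- A linear map on `R(S)` that vanishes on the ideal `I` descends to `Q = T(S) / (T(S) ∩ I)`. -/
def QSpace.lift {M : Type*} [AddCommGroup M] [Module ℝ M] (W : Submodule ℝ Poly) {S : Set X}
    (I : Ideal (RingAt S)) (Θ : RingAt S →ₗ[ℝ] M) (hΘ : ∀ x ∈ I, Θ x = 0) :
    QSpace W I →ₗ[ℝ] M :=
  (sumIdeal W I).liftQ (Θ ∘ₗ (sumSpace W S).subtype) fun _ hx => hΘ _ hx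

theorem QSpace.lift_injective {M : Type*} [AddCommGroup M] [Module ℝ M] (W : Submodule ℝ Poly)
    {S : Set X} (I : Ideal (RingAt S)) (Θ : RingAt S →ₗ[ℝ] M) (hΘ : ∀ x, x ∈ I ↔ Θ x = 0) :
    Function.Injective (QSpace.lift W I Θ fun x hx => (hΘ x).1 hx) := by
  rw [← LinearMap.ker_eq_bot]
  refine Submodule.ker_liftQ_eq_bot _ _ _ fun x hx => ?_
  exact (hΘ _).2 hx

theorem QSpace.range_lift {M : Type*} [AddCommGroup M] [Module ℝ M] (W : Submodule ℝ Poly)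
    {S : Set X} (I : Ideal (RingAt S)) (Θ : RingAt S →ₗ[ℝ] M) (hΘ : ∀ x ∈ I, Θ x = 0) :
    LinearMap.range (QSpace.lift W I Θ hΘ) =
      ⨆ σ : FacesAt S, W.map (Θ ∘ₗ (incl σ.2).toLinearMap) := by
  refine (Submodule.range_liftQ _ _ _).trans ?_
  rw [LinearMap.range_comp, Submodule.range_subtype, sumSpace, Submodule.map_iSup]
  simp only [Submodule.map_comp]

/-- `Q(S)` is spanned by the images of the polynomials on the faces that contain `S`. -/
theorem QSpace.iSup_range_faceMap (W : Submodule ℝ Poly) {S : Set X} (I : Ideal (RingAt S)) :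
    ⨆ σ : FacesAt S, LinearMap.range (faceMap W I σ.2) = ⊤ := by
  have hinj := QSpace.lift_injective W I (Ideal.Quotient.mkₐ ℝ I).toLinearMap
    (fun x => (Ideal.Quotient.eq_zero_iff_mem).symm)
  apply Submodule.map_injective_of_injective hinj
  rw [Submodule.map_iSup, Submodule.map_top, QSpace.range_lift]
  refine iSup_congr fun σ => ?_
  rw [← LinearMap.range_comp]
  ext y
  constructor
  · rintro ⟨f, rfl⟩
    exact ⟨f.1, f.2, rfl⟩
  · rintro ⟨f, hf, rfl⟩
    exact ⟨⟨f, hf⟩, rfl⟩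

instance QSpace.finiteDimensional [Finite (Face X)] (W : Submodule ℝ Poly)
    [FiniteDimensional ℝ W] {S : Set X} (I : Ideal (RingAt S)) :
    FiniteDimensional ℝ (QSpace W I) := by
  have : FiniteDimensional ℝ (⨆ σ : FacesAt S, LinearMap.range (faceMap W I σ.2) :
      Submodule ℝ (QSpace W I)) := inferInstance
  rw [QSpace.iSup_range_faceMap] at this
  exact Module.Finite.equiv Submodule.topEquiv

theorem QSpace.faceMap_eq_iff (W : Submodule ℝ Poly) {S : Set X} (I : Ideal (RingAt S))
    {σ σ' : Face X} (h : S ⊆ face σ) (h' : S ⊆ face σ') (f g : W) :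
    faceMap W I h f = faceMap W I h' g ↔ incl h (f : Poly) - incl h' (g : Poly) ∈ I := by
  have hinj := QSpace.lift_injective W I (Ideal.Quotient.mkₐ ℝ I).toLinearMap
    (fun x => (Ideal.Quotient.eq_zero_iff_mem).symm)
  rw [← hinj.eq_iff, ← Ideal.Quotient.eq]
  rfl

end QSpaceLemmas

/-! ### The ideal of an edge -/

section EdgeRing

variable {X : Type*} [TopologicalSpace X] [CWComplex (Set.univ : Set X)]
  {ψ : Face X → X → Fin 2 → ℝ} {r : ℕ}

/-- The ideal `I^r(τ)` of an edge `τ = σ₁ ∩ σ₂` is the kernel of the map from `R(τ)` to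
`R(σ₂) / I_σ₂(τ)^(r+1)` that is `φ` on `R(σ₁)` and the quotient map on `R(σ₂)`. -/
theorem exists_edgeHom {Φ : Transitions ψ r} (hΦ : IsCompatible Φ) {e : Edge X}
    {σ₁ σ₂ : Face X} (hne : σ₁ ≠ σ₂) (he : edge e = face σ₁ ∩ face σ₂)
    (honly : ∀ σ, edge e ⊆ face σ → σ = σ₁ ∨ σ = σ₂)
    (h₁ : edge e ⊆ face σ₁) (h₂ : edge e ⊆ face σ₂)
    {φ : JetHom ψ r (face σ₁ ∩ face σ₂) σ₁ σ₂} (hφ : φ ∈ Φ σ₁ σ₂) :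
    ∃ Θ : RingAt (edge e) →ₐ[ℝ] JetRing ψ r (face σ₁ ∩ face σ₂) σ₂,
      (∀ x, x ∈ edgeIdeal Φ e ↔ Θ x = 0) ∧
      (∀ f, Θ (incl h₁ f) = φ (Ideal.Quotient.mk _ f)) ∧
      (∀ f, Θ (incl h₂ f) = Ideal.Quotient.mk _ f) := by
  classical
  let Θ : RingAt (edge e) →ₐ[ℝ] JetRing ψ r (face σ₁ ∩ face σ₂) σ₂ :=
    MvPolynomial.aeval fun x => if x.1.1 = σ₁ then φ (Ideal.Quotient.mk _ (MvPolynomial.X x.2))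
      else Ideal.Quotient.mk _ (MvPolynomial.X x.2)
  have hΘ₁ : ∀ f, Θ (incl h₁ f) = φ (Ideal.Quotient.mk _ f) := by
    have : Θ.comp (incl h₁) = φ.comp (Ideal.Quotient.mkₐ ℝ _) :=
      MvPolynomial.algHom_ext fun i => by simp [Θ, incl]
    exact fun f => DFunLike.congr_fun this f
  have hΘ₂ : ∀ f, Θ (incl h₂ f) = Ideal.Quotient.mk _ f := by
    have : Θ.comp (incl h₂) = Ideal.Quotient.mkₐ ℝ _ :=
      MvPolynomial.algHom_ext fun i => by simp [Θ, incl, hne.symm]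
    exact fun f => DFunLike.congr_fun this f
  refine ⟨Θ, fun x => ⟨?_, fun hx => ?_⟩, hΘ₁, hΘ₂⟩
  · suffices h : edgeIdeal Φ e ≤ RingHom.ker Θ from fun hx => h hx
    refine iSup_le fun a => iSup_le fun b => iSup_le fun hab => iSup_le fun hab' =>
      iSup_le fun χ => iSup_le fun hχ => ?_
    have ha := honly a (hab'.subset.trans Set.inter_subset_left)
    have hb := honly b (hab'.subset.trans Set.inter_subset_right)
    have hz₁ : ∀ g ∈ idealOf ψ σ₁ (edge e) ^ (r + 1), Θ (incl h₁ g) = 0 := by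
      intro g hg
      rw [he] at hg
      rw [hΘ₁, Ideal.Quotient.eq_zero_iff_mem.2 hg, map_zero]
    have hz₂ : ∀ g ∈ idealOf ψ σ₂ (edge e) ^ (r + 1), Θ (incl h₂ g) = 0 := by
      intro g hg
      rw [he] at hg
      rw [hΘ₂, Ideal.Quotient.eq_zero_iff_mem.2 hg]
    rcases ha with rfl | rfl <;> rcases hb with rfl | rfl
    · exact absurd rfl hab
    · obtain rfl := hΦ.unique _ _ hφ hχ
      refine sup_le (sup_le (Ideal.span_le.2 ?_) (Ideal.map_le_iff_le_comap.2 hz₁))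
        (Ideal.map_le_iff_le_comap.2 hz₂)
      rintro _ ⟨i, g, hg, rfl⟩
      change Θ _ = 0
      rw [map_sub, hΘ₁, hΘ₂, hg, sub_self]
    · refine sup_le (sup_le (Ideal.span_le.2 ?_) (Ideal.map_le_iff_le_comap.2 hz₂))
        (Ideal.map_le_iff_le_comap.2 hz₁)
      rintro _ ⟨i, g, hg, rfl⟩
      change Θ _ = 0
      have hg' := (hΦ.inverse _ _ _ hφ _ hχ g (MvPolynomial.X i)).2 hg
      rw [map_sub, hΘ₁, hΘ₂, hg', sub_self]
    · exact absurd rfl hab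
  · have hle : gluingIdeal h₁ h₂ φ ≤ edgeIdeal Φ e := by
      refine le_trans ?_ (le_iSup_of_le σ₁ <| le_iSup_of_le σ₂ <| le_iSup_of_le hne <|
        le_iSup_of_le he <| le_iSup_of_le φ <| le_iSup_of_le hφ le_rfl)
      exact le_rfl
    let ι : JetRing ψ r (face σ₁ ∩ face σ₂) σ₂ →ₐ[ℝ] RingAt (edge e) ⧸ edgeIdeal Φ e :=
      Ideal.Quotient.liftₐ _ ((Ideal.Quotient.mkₐ ℝ _).comp (incl h₂)) fun g hg => by
        rw [← he] at hg
        refine Ideal.Quotient.eq_zero_iff_mem.2 (hle ?_)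
        exact Ideal.mem_sup_right (Ideal.mem_map_of_mem (incl h₂) hg)
    have hι : ι.comp Θ = Ideal.Quotient.mkₐ ℝ _ := by
      refine MvPolynomial.algHom_ext fun ⟨⟨ρ, hρ⟩, i⟩ => ?_
      rcases honly ρ hρ with rfl | rfl
      · obtain ⟨g, hg⟩ := Ideal.Quotient.mk_surjective
          (φ (Ideal.Quotient.mk _ (MvPolynomial.X i)))
        have h1 : Θ (MvPolynomial.X (⟨ρ, hρ⟩, i)) = Ideal.Quotient.mk _ g := by
          simp [Θ, hg]
        rw [AlgHom.comp_apply, h1]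
        change Ideal.Quotient.mk _ (incl h₂ g) = Ideal.Quotient.mk _ _
        refine (Ideal.Quotient.eq.2 (hle ?_)).symm
        refine Ideal.mem_sup_left (Ideal.mem_sup_left (Ideal.subset_span ⟨i, g, hg.symm, ?_⟩))
        simp [incl]
      · have h1 : Θ (MvPolynomial.X (⟨ρ, hρ⟩, i)) =
            Ideal.Quotient.mk _ (MvPolynomial.X i) := by
          simp [Θ, hne.symm]
        rw [AlgHom.comp_apply, h1]
        change Ideal.Quotient.mk _ (incl h₂ (MvPolynomial.X i)) = Ideal.Quotient.mk _ _
        simp [incl]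
    have := DFunLike.congr_fun hι x
    rw [AlgHom.comp_apply, hx, map_zero] at this
    exact Ideal.Quotient.eq_zero_iff_mem.1 this.symm

/-- Two polynomials on the faces at an edge agree in `Q` exactly if they join. -/
theorem faceMap_eq_iff_joins {Φ : Transitions ψ r} (hΦ : IsCompatible Φ) {e : Edge X}
    {σ₁ σ₂ : Face X} (hne : σ₁ ≠ σ₂) (he : edge e = face σ₁ ∩ face σ₂)
    (honly : ∀ σ, edge e ⊆ face σ → σ = σ₁ ∨ σ = σ₂)
    (h₁ : edge e ⊆ face σ₁) (h₂ : edge e ⊆ face σ₂)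
    {φ : JetHom ψ r (face σ₁ ∩ face σ₂) σ₁ σ₂} (hφ : φ ∈ Φ σ₁ σ₂) (W : Submodule ℝ Poly)
    (f g : W) :
    faceMap W (edgeIdeal Φ e) h₁ f = faceMap W (edgeIdeal Φ e) h₂ g ↔
      Joins φ (f : Poly) (g : Poly) := by
  obtain ⟨Θ, hker, hΘ₁, hΘ₂⟩ := exists_edgeHom hΦ hne he honly h₁ h₂ hφ
  rw [QSpace.faceMap_eq_iff, hker, map_sub, hΘ₁, hΘ₂, sub_eq_zero]
  rfl

end EdgeRing

/-! ### The cells of a vertex star -/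

section StarCombinatorics

variable {X : Type*} [TopologicalSpace X] [CWComplex (Set.univ : Set X)]
  {γ : Vertex X} {s : ℕ} {σ : ZMod s → Face X} {τ : ZMod s → Edge X}

theorem IsVertexStar.neZero (hs : IsVertexStar γ σ τ) : NeZero s :=
  ⟨by have := hs.three_le; omega⟩

theorem IsVertexStar.add_one_ne (hs : IsVertexStar γ σ τ) (t : ZMod s) : t + 1 ≠ t := by
  have : Fact (1 < s) := ⟨by have := hs.three_le; omega⟩
  simp

theorem IsVertexStar.face_ne (hs : IsVertexStar γ σ τ) (t : ZMod s) : σ t ≠ σ (t + 1) :=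
  fun h => hs.add_one_ne t (hs.bijective.1 h).symm

theorem IsVertexStar.subset_left (hs : IsVertexStar γ σ τ) (t : ZMod s) :
    edge (τ t) ⊆ face (σ t) :=
  (hs.inter t).symm.subset.trans Set.inter_subset_left

theorem IsVertexStar.subset_right (hs : IsVertexStar γ σ τ) (t : ZMod s) :
    edge (τ t) ⊆ face (σ (t + 1)) :=
  (hs.inter t).symm.subset.trans Set.inter_subset_right

theorem IsVertexStar.eq_or_eq (hs : IsVertexStar γ σ τ) (t : ZMod s) (ρ : Face X)
    (h : edge (τ t) ⊆ face ρ) : ρ = σ t ∨ ρ = σ (t + 1) := by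
  obtain ⟨t', rfl⟩ := hs.bijective.2 ρ
  rcases hs.only t t' h with rfl | rfl
  · exact Or.inl rfl
  · exact Or.inr rfl

theorem IsVertexStar.vert_subset (hs : IsVertexStar γ σ τ) (t : ZMod s) :
    vert γ ⊆ face (σ t) := (hs.mem t).trans (hs.subset_left t)

theorem IsVertexStar.isInteriorEdge (hs : IsVertexStar γ σ τ) (t : ZMod s) :
    IsInteriorEdge (τ t) := (hs.isInteriorEdge_iff _).2 ⟨t, rfl⟩

theorem IsVertexStar.isInteriorVertex (hs : IsVertexStar γ σ τ) :
    IsInteriorVertex γ := (hs.isInteriorVertex_iff _).2 rfl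

theorem IsVertexStar.mem_range (hs : IsVertexStar γ σ τ) (e : Edge X) (he : vert γ ⊆ edge e) :
    ∃ t, τ t = e :=
  (hs.isInteriorEdge_iff _).1 (hs.isInteriorVertex e he)

/-- `τ t` as an interior edge. -/
abbrev IsVertexStar.interiorEdge (hs : IsVertexStar γ σ τ) (t : ZMod s) : InteriorEdge X :=
  ⟨τ t, hs.isInteriorEdge t⟩

theorem IsVertexStar.interiorEdge_bijective (hs : IsVertexStar γ σ τ) :
    Function.Bijective hs.interiorEdge :=
  ⟨fun _ _ h => hs.injective (Subtype.ext_iff.1 h), fun ⟨e, he⟩ => by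
    obtain ⟨t, rfl⟩ := (hs.isInteriorEdge_iff e).1 he
    exact ⟨t, rfl⟩⟩

/-- The 2-faces of a vertex star, indexed by `ZMod s`. -/
def IsVertexStar.faceEquiv (hs : IsVertexStar γ σ τ) : ZMod s ≃ Face X :=
  Equiv.ofBijective σ hs.bijective

theorem IsVertexStar.eq_interiorVertex (hs : IsVertexStar γ σ τ) (v : InteriorVertex X) :
    v = ⟨γ, hs.isInteriorVertex⟩ :=
  Subtype.ext ((hs.isInteriorVertex_iff _).1 v.2)

theorem IsVertexStar.vertIdeal_eq {ψ : Face X → X → Fin 2 → ℝ} {r : ℕ}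
    (hs : IsVertexStar γ σ τ) (Φ : Transitions ψ r) :
    vertIdeal Φ γ = ⨆ t, (edgeIdeal Φ (τ t)).map (res (hs.mem t)) := by
  refine le_antisymm (iSup₂_le fun e he => ?_) (iSup_le fun t => map_edgeIdeal_le Φ (hs.mem t))
  obtain ⟨t, rfl⟩ := hs.mem_range e he
  exact le_iSup (fun t => (edgeIdeal Φ (τ t)).map (res (hs.mem t))) t

theorem IsVertexStar.joins_iff {ψ : Face X → X → Fin 2 → ℝ} {r : ℕ}
    (hs : IsVertexStar γ σ τ) {Φ : Transitions ψ r} (hΦ : IsCompatible Φ) (t : ZMod s)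
    {φ : JetHom ψ r (face (σ t) ∩ face (σ (t + 1))) (σ t) (σ (t + 1))}
    (hφ : φ ∈ Φ (σ t) (σ (t + 1))) (W : Submodule ℝ Poly) (f g : W) :
    faceMap W (edgeIdeal Φ (τ t)) (hs.subset_left t) f =
      faceMap W (edgeIdeal Φ (τ t)) (hs.subset_right t) g ↔ Joins φ (f : Poly) (g : Poly) :=
  faceMap_eq_iff_joins hΦ (hs.face_ne t) (hs.inter t).symm (hs.eq_or_eq t) _ _ hφ W f g

theorem IsVertexStar.joins_iff' {ψ : Face X → X → Fin 2 → ℝ} {r : ℕ}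
    (hs : IsVertexStar γ σ τ) {Φ : Transitions ψ r} (hΦ : IsCompatible Φ) (t : ZMod s)
    {φ : JetHom ψ r (face (σ (t + 1)) ∩ face (σ t)) (σ (t + 1)) (σ t)}
    (hφ : φ ∈ Φ (σ (t + 1)) (σ t)) (W : Submodule ℝ Poly) (f g : W) :
    faceMap W (edgeIdeal Φ (τ t)) (hs.subset_left t) f =
      faceMap W (edgeIdeal Φ (τ t)) (hs.subset_right t) g ↔ Joins φ (g : Poly) (f : Poly) := by
  rw [eq_comm]
  exact faceMap_eq_iff_joins hΦ (hs.face_ne t).symm ((hs.inter t).symm.trans (Set.inter_comm _ _))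
    (fun ρ h => (hs.eq_or_eq t ρ h).symm) _ _ hφ W g f

/-- The splines on a vertex star are the tuples whose members agree in `Q(τ t)` for all `t`. -/
theorem IsVertexStar.mem_splines_iff {ψ : Face X → X → Fin 2 → ℝ} {r : ℕ}
    (hs : IsVertexStar γ σ τ) {Φ : Transitions ψ r} (hΦ : IsCompatible Φ)
    (W : Submodule ℝ Poly) (f : Face X → W) :
    (fun ρ => (f ρ : Poly)) ∈ splines Φ W ↔
      ∀ t, faceMap W (edgeIdeal Φ (τ t)) (hs.subset_left t) (f (σ t)) =
        faceMap W (edgeIdeal Φ (τ t)) (hs.subset_right t) (f (σ (t + 1))) := by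
  constructor
  · rintro ⟨-, hf⟩ t
    have hcell : IsCell (face (σ t) ∩ face (σ (t + 1))) := ⟨1, τ t, hs.inter t⟩
    rcases hΦ.exists_map _ _ hcell with ⟨φ, hφ⟩ | ⟨φ, hφ⟩
    · exact (hs.joins_iff hΦ t hφ W _ _).2 (hf _ _ (τ t) (hs.face_ne t) (hs.inter t) φ hφ)
    · exact (hs.joins_iff' hΦ t hφ W _ _).2 (hf _ _ (τ t) (hs.face_ne t).symm
        ((Set.inter_comm _ _).trans (hs.inter t)) φ hφ)
  · refine fun hf => ⟨fun ρ => (f ρ).2, fun ρ ρ' e hne he φ hφ => ?_⟩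
    have h : edge e ⊆ face ρ := he.symm.subset.trans Set.inter_subset_left
    have h' : edge e ⊆ face ρ' := he.symm.subset.trans Set.inter_subset_right
    obtain ⟨t, rfl⟩ := (hs.isInteriorEdge_iff e).1 ⟨ρ, ρ', hne, h, h'⟩
    rcases hs.eq_or_eq t ρ h with rfl | rfl <;> rcases hs.eq_or_eq t ρ' h' with rfl | rfl
    · exact absurd rfl hne
    · exact (hs.joins_iff hΦ t hφ W _ _).1 (hf t)
    · exact (hs.joins_iff' hΦ t hφ W _ _).1 (hf t)
    · exact absurd rfl hne

end StarCombinatorics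

/-! ### The differentials on a vertex star -/

section StarComplex

variable {X : Type*} [TopologicalSpace X] [CWComplex (Set.univ : Set X)]
  [Fintype (Vertex X)] [Fintype (Edge X)]
  {γ : Vertex X} {s : ℕ} {σ : ZMod s → Face X} {τ : ZMod s → Edge X}

theorem IsVertexStar.faceEdge_mul_self (hs : IsVertexStar γ σ τ) (o : CellOrientation X)
    (t : ZMod s) : o.faceEdge (σ t) (τ t) * o.faceEdge (σ t) (τ t) = 1 := by
  rcases o.faceEdge_of_subset _ _ (hs.subset_left t) with h | h <;> rw [h] <;> rfl

theorem IsVertexStar.edgeVert_mul_self (hs : IsVertexStar γ σ τ) (o : CellOrientation X)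
    (t : ZMod s) : o.edgeVert (τ t) γ * o.edgeVert (τ t) γ = 1 := by
  rcases o.edgeVert_of_subset _ _ (hs.mem t) with h | h <;> rw [h] <;> rfl

/-- The sign by which the orientation of the face `σ t` differs from the orientation for which the
incidence number of `σ t` and `τ t` is that of `τ t` and `γ`. -/
def starSign (o : CellOrientation X) (γ : Vertex X) (σ : ZMod s → Face X) (τ : ZMod s → Edge X)
    (t : ZMod s) : ℤ :=
  o.faceEdge (σ t) (τ t) * o.edgeVert (τ t) γ

theorem IsVertexStar.starSign_mul_self (hs : IsVertexStar γ σ τ) (o : CellOrientation X)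
    (t : ZMod s) : starSign o γ σ τ t * starSign o γ σ τ t = 1 := by
  have h1 := hs.faceEdge_mul_self o t
  have h2 := hs.edgeVert_mul_self o t
  rw [starSign, mul_mul_mul_comm, h1, h2, one_mul]

theorem IsVertexStar.faceEdge_mul_starSign (hs : IsVertexStar γ σ τ) (o : CellOrientation X)
    (t : ZMod s) : o.faceEdge (σ t) (τ t) * starSign o γ σ τ t = o.edgeVert (τ t) γ := by
  rw [starSign, ← mul_assoc, hs.faceEdge_mul_self o t, one_mul]

/-- The two edges of `σ (t + 1)` at `γ` contribute opposite signs to the coefficient of `γ` in the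
boundary of the boundary of `σ (t + 1)`. -/
theorem IsVertexStar.faceEdge_mul_starSign_succ (hs : IsVertexStar γ σ τ)
    (o : CellOrientation X) (t : ZMod s) :
    o.faceEdge (σ (t + 1)) (τ t) * starSign o γ σ τ (t + 1) = - o.edgeVert (τ t) γ := by
  classical
  have hsum := o.sum_faceEdge_mul_edgeVert (σ (t + 1)) γ
  have hne : τ (t + 1) ≠ τ t := fun h => hs.add_one_ne t (hs.injective h)
  rw [Finset.sum_eq_add (τ (t + 1)) (τ t) hne ?_ (by simp) (by simp)] at hsum
  · have h1 := hs.edgeVert_mul_self o t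
    have h2 := hs.starSign_mul_self o (t + 1)
    rw [starSign] at h2 ⊢
    linear_combination o.edgeVert (τ t) γ * (o.faceEdge (σ (t + 1)) (τ (t + 1)) *
      o.edgeVert (τ (t + 1)) γ) * hsum - o.edgeVert (τ t) γ * h2 -
      o.faceEdge (σ (t + 1)) (τ t) * (o.faceEdge (σ (t + 1)) (τ (t + 1)) *
      o.edgeVert (τ (t + 1)) γ) * h1
  · rintro e - ⟨h1, h2⟩
    by_cases hv : vert γ ⊆ edge e
    · obtain ⟨t', rfl⟩ := hs.mem_range e hv
      rw [o.faceEdge_of_not_subset, zero_mul]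
      intro h
      rcases hs.only t' _ h with h | h
      · exact h1 (by rw [h])
      · exact h2 (by rw [add_right_cancel h])
    · rw [o.edgeVert_of_not_subset _ _ hv, mul_zero]

variable {ψ : Face X → X → Fin 2 → ℝ} {r : ℕ}

/-- The involution of the 2-chains that changes the orientations of the faces by the signs
`starSign`. -/
def starTwist (hs : IsVertexStar γ σ τ) (o : CellOrientation X) (W : Submodule ℝ Poly) :
    Chain₂ X W →ₗ[ℝ] Chain₂ X W :=
  LinearMap.pi fun ρ => starSign o γ σ τ (hs.faceEquiv.symm ρ) • LinearMap.proj ρ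

theorem starTwist_apply (hs : IsVertexStar γ σ τ) (o : CellOrientation X) (W : Submodule ℝ Poly)
    (F : Chain₂ X W) (t : ZMod s) :
    starTwist hs o W F (σ t) = starSign o γ σ τ t • F (σ t) := by
  have h : hs.faceEquiv.symm (σ t) = t := hs.faceEquiv.symm_apply_apply t
  change starSign o γ σ τ (hs.faceEquiv.symm (σ t)) • F (σ t) = _
  rw [h]

theorem starTwist_starTwist (hs : IsVertexStar γ σ τ) (o : CellOrientation X)
    (W : Submodule ℝ Poly) (F : Chain₂ X W) : starTwist hs o W (starTwist hs o W F) = F := by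
  funext ρ
  obtain ⟨t, rfl⟩ := hs.bijective.2 ρ
  rw [starTwist_apply, starTwist_apply, smul_smul, hs.starSign_mul_self, one_smul]

/-- After the change of orientation, the boundary of a 2-chain is, up to the sign of each edge, the
tuple of the differences of consecutive members. -/
theorem δ₂_starTwist [Fintype (Face X)] (hs : IsVertexStar γ σ τ) (o : CellOrientation X)
    (Φ : Transitions ψ r)
    (W : Submodule ℝ Poly) (F : Chain₂ X W) (t : ZMod s) :
    δ₂ o Φ W (starTwist hs o W F) (hs.interiorEdge t) = o.edgeVert (τ t) γ •
      (faceMap W (edgeIdeal Φ (τ t)) (hs.subset_left t) (F (σ t)) -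
        faceMap W (edgeIdeal Φ (τ t)) (hs.subset_right t) (F (σ (t + 1)))) := by
  classical
  simp only [δ₂, LinearMap.pi_apply, LinearMap.sum_apply]
  rw [Finset.sum_eq_add (σ t) (σ (t + 1)) (hs.face_ne t) ?_ (by simp) (by simp)]
  · rw [dif_pos (hs.subset_left t), dif_pos (hs.subset_right t)]
    simp only [LinearMap.smul_apply, LinearMap.comp_apply, LinearMap.proj_apply]
    rw [starTwist_apply, starTwist_apply, map_zsmul, map_zsmul, smul_smul, smul_smul,
      hs.faceEdge_mul_starSign, hs.faceEdge_mul_starSign_succ, neg_smul, smul_sub, sub_eq_add_neg]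
  · rintro ρ - ⟨h1, h2⟩
    rw [dif_neg]
    · simp
    · intro h
      rcases hs.eq_or_eq t ρ h with h | h
      · exact h1 h
      · exact h2 h

theorem edgeVert_smul_eq_zero_iff (hs : IsVertexStar γ σ τ) (o : CellOrientation X) (t : ZMod s)
    {M : Type*} [AddCommGroup M] (x : M) :
    o.edgeVert (τ t) γ • x = 0 ↔ x = 0 := by
  rcases o.edgeVert_of_subset _ _ (hs.mem t) with h | h <;> simp [h]

/-- The splines are, up to the signs `starSign`, the 2-cycles of the complex. -/
theorem finrank_splines [Fintype (Face X)] (hs : IsVertexStar γ σ τ) (o : CellOrientation X)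
    {Φ : Transitions ψ r}
    (hΦ : IsCompatible Φ) (W : Submodule ℝ Poly) :
    Module.finrank ℝ (splines Φ W) = Module.finrank ℝ (LinearMap.ker (δ₂ o Φ W)) := by
  let T : Chain₂ X W ≃ₗ[ℝ] Chain₂ X W :=
    LinearEquiv.ofInvolutive (starTwist hs o W) (starTwist_starTwist hs o W)
  let L : Chain₂ X W →ₗ[ℝ] (Face X → Poly) :=
    LinearMap.pi fun ρ => W.subtype ∘ₗ LinearMap.proj ρ
  have hL : Function.Injective L := fun F G h => by
    funext ρ
    exact Subtype.ext (congrFun h ρ)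
  have hmem : ∀ F : Chain₂ X W, L F ∈ splines Φ W ↔ T F ∈ LinearMap.ker (δ₂ o Φ W) := by
    intro F
    refine (hs.mem_splines_iff hΦ W F).trans ?_
    rw [LinearMap.mem_ker]
    have : (∀ t, δ₂ o Φ W (T F) (hs.interiorEdge t) = 0) ↔ δ₂ o Φ W (T F) = 0 := by
      rw [funext_iff]
      exact (hs.interiorEdge_bijective.2.forall (p := fun e => δ₂ o Φ W (T F) e = 0)).symm
    rw [← this]
    refine forall_congr' fun t => ?_
    have h := δ₂_starTwist hs o Φ W F t
    change δ₂ o Φ W (T F) (hs.interiorEdge t) = _ at h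
    rw [h, edgeVert_smul_eq_zero_iff hs o, sub_eq_zero]
  have h1 : splines Φ W = ((LinearMap.ker (δ₂ o Φ W)).comap T.toLinearMap).map L := by
    ext f
    constructor
    · intro hf
      have : L (fun ρ => ⟨f ρ, hf.1 ρ⟩) = f := rfl
      rw [← this] at hf ⊢
      exact Submodule.mem_map_of_mem ((hmem _).1 hf)
    · rintro ⟨F, hF, rfl⟩
      exact (hmem F).2 hF
  have h2 : (LinearMap.ker (δ₂ o Φ W)).comap T.toLinearMap =
      (LinearMap.ker (δ₂ o Φ W)).map T.symm.toLinearMap :=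
    (Submodule.map_equiv_eq_comap_symm T.symm _).symm
  rw [h1, ← (Submodule.equivMapOfInjective L hL _).finrank_eq, h2]
  exact LinearEquiv.finrank_map_eq T.symm _

/-- The boundary map onto `Q(γ)`, applied to a chain on a single edge. -/
theorem δ₁_single (hs : IsVertexStar γ σ τ) (o : CellOrientation X) (Φ : Transitions ψ r)
    (W : Submodule ℝ Poly) [DecidableEq (InteriorEdge X)] (t : ZMod s)
    (x : QSpace W (edgeIdeal Φ (τ t))) :
    δ₁ o Φ W (Pi.single (hs.interiorEdge t) x) ⟨γ, hs.isInteriorVertex⟩ =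
      o.edgeVert (τ t) γ • quotMap W (hs.mem t) (edgeIdeal Φ (τ t)) (vertIdeal Φ γ)
        (map_edgeIdeal_le Φ (hs.mem t)) x := by
  simp only [δ₁, LinearMap.pi_apply, LinearMap.sum_apply]
  rw [Finset.sum_eq_single (hs.interiorEdge t)]
  · have h : vert γ ⊆ edge (hs.interiorEdge t).1 := hs.mem t
    rw [dif_pos h]
    simp only [LinearMap.smul_apply, LinearMap.comp_apply, LinearMap.proj_apply, Pi.single_eq_same]
  · intro e _ hne
    split_ifs
    · simp only [LinearMap.smul_apply, LinearMap.comp_apply, LinearMap.proj_apply]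
      rw [Pi.single_eq_of_ne hne, map_zero, smul_zero]
    · simp
  · simp

/-- Each face has an interior edge through `γ`, so every generator of `Q(γ)` comes from an edge. -/
theorem δ₁_surjective (hs : IsVertexStar γ σ τ) (o : CellOrientation X) (Φ : Transitions ψ r)
    (W : Submodule ℝ Poly) : Function.Surjective (δ₁ o Φ W) := by
  classical
  let P : Chain₀ Φ W →ₗ[ℝ] QSpace W (vertIdeal Φ γ) :=
    LinearMap.proj (φ := fun v : InteriorVertex X => QSpace W (vertIdeal Φ v.1))
      ⟨γ, hs.isInteriorVertex⟩
  have hP : Function.Injective P := fun a b h => by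
    funext v
    obtain rfl := hs.eq_interiorVertex v
    exact h
  have key : Function.Surjective (P ∘ₗ δ₁ o Φ W) := by
    rw [← LinearMap.range_eq_top, eq_top_iff, ← QSpace.iSup_range_faceMap]
    refine iSup_le fun ⟨ρ, hρ⟩ => ?_
    rintro _ ⟨f, rfl⟩
    obtain ⟨t, rfl⟩ := hs.bijective.2 ρ
    refine ⟨Pi.single (hs.interiorEdge t)
      (o.edgeVert (τ t) γ • faceMap W (edgeIdeal Φ (τ t)) (hs.subset_left t) f), ?_⟩
    refine (δ₁_single hs o Φ W t _).trans ?_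
    rw [map_zsmul, smul_smul, hs.edgeVert_mul_self, one_smul, quotMap_faceMap]
  intro y
  obtain ⟨x, hx⟩ := key (P y)
  exact ⟨x, hP hx⟩

end StarComplex

/-! ### Dimension count for the complex of a vertex star -/

section DimensionCount

variable {X : Type*} [TopologicalSpace X] [CWComplex (Set.univ : Set X)]
  {γ : Vertex X} {s : ℕ} {σ : ZMod s → Face X} {τ : ZMod s → Edge X}
  {ψ : Face X → X → Fin 2 → ℝ} {r : ℕ}

theorem IsVertexStar.finrank_chain₀ [Fintype (Vertex X)] [Finite (Face X)]
    (hs : IsVertexStar γ σ τ) (Φ : Transitions ψ r) (W : Submodule ℝ Poly) [FiniteDimensional ℝ W] :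
    Module.finrank ℝ (Chain₀ Φ W) = Module.finrank ℝ (QSpace W (vertIdeal Φ γ)) := by
  classical
  rw [Module.finrank_pi_fintype, Finset.sum_eq_single ⟨γ, hs.isInteriorVertex⟩]
  · exact fun v _ h => absurd (hs.eq_interiorVertex v) h
  · simp

variable [Fintype (Vertex X)] [Fintype (Edge X)] [Fintype (Face X)]

theorem eulerChar_eq_finrank (Φ : Transitions ψ r) (W : Submodule ℝ Poly)
    [FiniteDimensional ℝ W] :
    eulerChar Φ W = (Module.finrank ℝ (Chain₂ X W) : ℤ) - Module.finrank ℝ (Chain₁ Φ W) +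
      Module.finrank ℝ (Chain₀ Φ W) := by
  classical
  rw [Module.finrank_pi_fintype, Module.finrank_pi_fintype, Module.finrank_pi_fintype, eulerChar]
  push_cast
  congr! 5

theorem finrank_H₁ (o : CellOrientation X) (Φ : Transitions ψ r) (W : Submodule ℝ Poly)
    [FiniteDimensional ℝ W] :
    Module.finrank ℝ (H₁ o Φ W) + Module.finrank ℝ (LinearMap.range (δ₂ o Φ W)) =
      Module.finrank ℝ (LinearMap.ker (δ₁ o Φ W)) := by
  have hle : LinearMap.range (δ₂ o Φ W) ≤ LinearMap.ker (δ₁ o Φ W) :=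
    LinearMap.range_le_ker_iff.2 (δ₁_comp_δ₂ o Φ W)
  rw [← (Submodule.submoduleOfEquivOfLe hle).finrank_eq]
  exact Submodule.finrank_quotient_add_finrank _

theorem finrank_splines_eq_add (hs : IsVertexStar γ σ τ) (o : CellOrientation X)
    {Φ : Transitions ψ r} (hΦ : IsCompatible Φ) (W : Submodule ℝ Poly) [FiniteDimensional ℝ W] :
    (Module.finrank ℝ (splines Φ W) : ℤ) = eulerChar Φ W + Module.finrank ℝ (H₁ o Φ W) := by
  have h1 := finrank_splines hs o hΦ W
  have h2 := finrank_H₁ o Φ W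
  have h3 := LinearMap.finrank_range_add_finrank_ker (δ₂ o Φ W)
  have h4 := LinearMap.finrank_range_add_finrank_ker (δ₁ o Φ W)
  rw [LinearMap.range_eq_top.2 (δ₁_surjective hs o Φ W), finrank_top] at h4
  rw [eulerChar_eq_finrank]
  omega

/-- `H₁` vanishes as soon as the cokernel of `δ₂` is not larger than `Q(γ)`, onto which it maps. -/
theorem finrank_splines_eq_eulerChar (hs : IsVertexStar γ σ τ) (o : CellOrientation X)
    {Φ : Transitions ψ r} (hΦ : IsCompatible Φ) (W : Submodule ℝ Poly) [FiniteDimensional ℝ W]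
    (h : Module.finrank ℝ (Chain₁ Φ W ⧸ LinearMap.range (δ₂ o Φ W)) ≤
      Module.finrank ℝ (QSpace W (vertIdeal Φ γ))) :
    (Module.finrank ℝ (splines Φ W) : ℤ) = eulerChar Φ W := by
  have h1 := finrank_splines hs o hΦ W
  have h2 := finrank_splines_eq_add hs o hΦ W
  have h3 := LinearMap.finrank_range_add_finrank_ker (δ₂ o Φ W)
  have h4 := Submodule.finrank_quotient_add_finrank (LinearMap.range (δ₂ o Φ W))
  rw [← hs.finrank_chain₀] at h
  have h5 := eulerChar_eq_finrank Φ W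
  omega

theorem IsVertexStar.eulerChar_eq [NeZero s] (hs : IsVertexStar γ σ τ) (Φ : Transitions ψ r)
    (W : Submodule ℝ Poly) [FiniteDimensional ℝ W] :
    eulerChar Φ W = s * (Module.finrank ℝ W : ℤ) -
      ∑ t, (Module.finrank ℝ (QSpace W (edgeIdeal Φ (τ t))) : ℤ) +
        Module.finrank ℝ (QSpace W (vertIdeal Φ γ)) := by
  classical
  rw [← hs.finrank_chain₀, eulerChar_eq_finrank, Module.finrank_pi_fintype,
    Module.finrank_pi_fintype]
  have h1 : Fintype.card (Face X) = s := by
    rw [← Fintype.card_of_bijective hs.bijective, ZMod.card]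
  have h2 := Fintype.sum_bijective hs.interiorEdge hs.interiorEdge_bijective
    (fun t => Module.finrank ℝ (QSpace W (edgeIdeal Φ (τ t))))
    (fun e => Module.finrank ℝ (QSpace W (edgeIdeal Φ e.1))) fun _ => rfl
  rw [← h2, Finset.sum_const, Finset.card_univ, h1, smul_eq_mul]
  push_cast
  rfl

/-- The cokernel of `δ₂` is the sum of the images of one copy of `W` for each face, and members of
`W` that agree across `τ t` have the same image: it is the quotient of the sum of the spaces `W`
by the relations that hold along the edges. -/
theorem exists_cokernel_maps (hs : IsVertexStar γ σ τ) (o : CellOrientation X)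
    (Φ : Transitions ψ r) (W : Submodule ℝ Poly) :
    ∃ F : ZMod s → W →ₗ[ℝ] Chain₁ Φ W ⧸ LinearMap.range (δ₂ o Φ W),
      ⨆ t, LinearMap.range (F t) = ⊤ ∧
      ∀ t (f g : W), faceMap W (edgeIdeal Φ (τ t)) (hs.subset_left t) f =
        faceMap W (edgeIdeal Φ (τ t)) (hs.subset_right t) g → F t f = F (t + 1) g := by
  classical
  let E (t : ZMod s) : QSpace W (edgeIdeal Φ (τ t)) →ₗ[ℝ]
      Chain₁ Φ W ⧸ LinearMap.range (δ₂ o Φ W) :=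
    (LinearMap.range (δ₂ o Φ W)).mkQ ∘ₗ
      LinearMap.single ℝ (fun e : InteriorEdge X => QSpace W (edgeIdeal Φ e.1))
        (hs.interiorEdge t)
  let F (t : ZMod s) : W →ₗ[ℝ] Chain₁ Φ W ⧸ LinearMap.range (δ₂ o Φ W) :=
    o.edgeVert (τ t) γ • (E t ∘ₗ faceMap W (edgeIdeal Φ (τ t)) (hs.subset_left t))
  have hF : ∀ t f, F (t + 1) f = o.edgeVert (τ t) γ •
      E t (faceMap W (edgeIdeal Φ (τ t)) (hs.subset_right t) f) := by
    intro t f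
    change o.edgeVert (τ (t + 1)) γ • (LinearMap.range (δ₂ o Φ W)).mkQ _ =
      o.edgeVert (τ t) γ • (LinearMap.range (δ₂ o Φ W)).mkQ _
    rw [← map_zsmul, ← map_zsmul]
    refine (Submodule.Quotient.eq _).2 ⟨starTwist hs o W (Pi.single (σ (t + 1)) f), ?_⟩
    funext e
    obtain ⟨t', rfl⟩ := hs.interiorEdge_bijective.2 e
    rw [δ₂_starTwist]
    have hinj := hs.interiorEdge_bijective.1
    simp only [LinearMap.coe_single, Pi.sub_apply,
      Pi.smul_apply]
    by_cases h1 : t' = t + 1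
    · subst h1
      have h2 : σ (t + 1 + 1) ≠ σ (t + 1) := fun h => hs.add_one_ne _ (hs.bijective.1 h)
      have h3 : hs.interiorEdge (t + 1) ≠ hs.interiorEdge t := fun h => hs.add_one_ne _ (hinj h)
      rw [Pi.single_eq_same, Pi.single_eq_same, Pi.single_eq_of_ne h2, Pi.single_eq_of_ne h3,
        map_zero, smul_zero, sub_zero, sub_zero]
    · have h2 : σ t' ≠ σ (t + 1) := fun h => h1 (hs.bijective.1 h)
      have h3 : hs.interiorEdge t' ≠ hs.interiorEdge (t + 1) := fun h => h1 (hinj h)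
      rw [Pi.single_eq_of_ne h2, Pi.single_eq_of_ne h3, map_zero]
      by_cases h4 : t' = t
      · subst h4
        rw [Pi.single_eq_same, Pi.single_eq_same, smul_sub, smul_zero]
      · have h5 : σ (t' + 1) ≠ σ (t + 1) :=
          fun h => h4 (add_right_cancel (hs.bijective.1 h))
        have h6 : hs.interiorEdge t' ≠ hs.interiorEdge t := fun h => h4 (hinj h)
        rw [Pi.single_eq_of_ne h5, Pi.single_eq_of_ne h6, map_zero, smul_zero, sub_zero, smul_zero]
  have hunit : ∀ t (x : Chain₁ Φ W ⧸ LinearMap.range (δ₂ o Φ W)),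
      o.edgeVert (τ t) γ • o.edgeVert (τ t) γ • x = x := fun t x => by
    rw [smul_smul, hs.edgeVert_mul_self, one_smul]
  refine ⟨F, ?_, fun t f g h => ?_⟩
  · rw [eq_top_iff]
    rintro y -
    obtain ⟨x, rfl⟩ := Submodule.mkQ_surjective _ y
    rw [← LinearMap.sum_single_apply _ x, map_sum]
    refine Submodule.sum_mem _ fun e _ => ?_
    obtain ⟨t, rfl⟩ := hs.interiorEdge_bijective.2 e
    have hle : ⨆ ρ : FacesAt (edge (τ t)), LinearMap.range (faceMap W (edgeIdeal Φ (τ t)) ρ.2) ≤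
        (⨆ t, LinearMap.range (F t)).comap (E t) := by
      refine iSup_le fun ⟨ρ, hρ⟩ => ?_
      rintro _ ⟨f, rfl⟩
      rw [Submodule.mem_comap, ← hunit t (E t _)]
      refine zsmul_mem ?_ _
      rcases hs.eq_or_eq t ρ hρ with rfl | rfl
      · exact Submodule.mem_iSup_of_mem t ⟨f, rfl⟩
      · rw [← hF]
        exact Submodule.mem_iSup_of_mem (t + 1) ⟨f, rfl⟩
    rw [QSpace.iSup_range_faceMap] at hle
    exact hle trivial
  · rw [hF, ← h]
    rfl

end DimensionCount

/-! ### First jets along an edge -/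

section Jets

open Polynomial in
/-- The first jet of a polynomial `f(u, v)` along `v = 0`, as the pair of `f(u, 0)` and
`f_v(u, 0)`: the algebra map to `ℝ[X][ε]` with `u ↦ X` and `v ↦ ε`. -/
def jetRight : Poly →ₐ[ℝ] DualNumber ℝ[X] :=
  MvPolynomial.aeval ![TrivSqZeroExt.inl Polynomial.X, DualNumber.eps]

open Polynomial in
/-- The first jet of `f(-v, u + v a(u))` along `v = 0`: the algebra map to `ℝ[X][ε]` with
`u ↦ -ε` and `v ↦ X + ε a`. -/
def jetLeft (a : ℝ[X]) : Poly →ₐ[ℝ] DualNumber ℝ[X] :=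
  MvPolynomial.aeval ![-DualNumber.eps, TrivSqZeroExt.inl Polynomial.X + TrivSqZeroExt.inr a]

@[simp] theorem jetRight_X_zero :
    jetRight (MvPolynomial.X 0) = TrivSqZeroExt.inl Polynomial.X := by simp [jetRight]

@[simp] theorem jetRight_X_one : jetRight (MvPolynomial.X 1) = DualNumber.eps := by
  simp [jetRight]

@[simp] theorem jetLeft_X_zero (a : Polynomial ℝ) :
    jetLeft a (MvPolynomial.X 0) = -DualNumber.eps := by simp [jetLeft]

@[simp] theorem jetLeft_X_one (a : Polynomial ℝ) : jetLeft a (MvPolynomial.X 1) =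
    TrivSqZeroExt.inl Polynomial.X + TrivSqZeroExt.inr a := by simp [jetLeft]

@[simp] theorem jetRight_aeval (p : Polynomial ℝ) :
    jetRight (Polynomial.aeval (MvPolynomial.X 0 : Poly) p) = TrivSqZeroExt.inl p := by
  have h : jetRight.comp (Polynomial.aeval (MvPolynomial.X 0 : Poly)) =
      TrivSqZeroExt.inlAlgHom ℝ (Polynomial ℝ) (Polynomial ℝ) := by
    apply Polynomial.algHom_ext
    simp
  exact DFunLike.congr_fun h p

theorem eps_pow_eq_zero {R : Type*} [CommRing R] {n : ℕ} (hn : 2 ≤ n) :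
    (DualNumber.eps : DualNumber R) ^ n = 0 := by
  obtain ⟨k, rfl⟩ := Nat.exists_eq_add_of_le hn
  rw [pow_add, DualNumber.eps_pow_two, zero_mul]

theorem monomial_eq (m : Fin 2 →₀ ℕ) (c : ℝ) :
    (MvPolynomial.monomial m c : Poly) =
      c • (MvPolynomial.X 0 ^ m 0 * MvPolynomial.X 1 ^ m 1) := by
  rw [MvPolynomial.monomial_eq, Finsupp.prod_fintype _ _ (by simp), Fin.prod_univ_two,
    MvPolynomial.smul_eq_C_mul]

theorem jetRight_monomial (m : Fin 2 →₀ ℕ) (c : ℝ) :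
    jetRight (MvPolynomial.monomial m c) =
      c • (TrivSqZeroExt.inl (Polynomial.X ^ m 0) * DualNumber.eps ^ m 1) := by
  rw [monomial_eq, map_smul, map_mul, map_pow, map_pow, jetRight_X_zero, jetRight_X_one,
    TrivSqZeroExt.inl_pow]

theorem fst_jetRight_coeff (f : Poly) (k : ℕ) :
    (jetRight f).fst.coeff k = f.coeff (Finsupp.single 0 k) := by
  induction f using MvPolynomial.induction_on' with
  | monomial m c =>
    rw [jetRight_monomial, MvPolynomial.coeff_monomial]
    have hm : m = Finsupp.single 0 k ↔ m 0 = k ∧ m 1 = 0 := by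
      constructor
      · rintro rfl; simp
      · rintro ⟨h1, h2⟩; ext i; fin_cases i <;> simp [h1, h2]
    simp only [hm]
    rcases Nat.eq_zero_or_pos (m 1) with h | h
    · simp [h, Polynomial.coeff_X_pow, eq_comm]
    · have : m 1 ≠ 0 := by omega
      simp [this]
  | add p q hp hq => simp [hp, hq]

theorem snd_jetRight_coeff (f : Poly) (k : ℕ) :
    (jetRight f).snd.coeff k = f.coeff (Finsupp.single 0 k + Finsupp.single 1 1) := by
  induction f using MvPolynomial.induction_on' with
  | monomial m c =>
    rw [jetRight_monomial, MvPolynomial.coeff_monomial]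
    have hm : m = Finsupp.single 0 k + Finsupp.single 1 1 ↔ m 0 = k ∧ m 1 = 1 := by
      constructor
      · rintro rfl; simp
      · rintro ⟨h1, h2⟩; ext i; fin_cases i <;> simp [h1, h2]
    simp only [hm]
    rcases Nat.lt_or_ge (m 1) 2 with h | h
    · interval_cases h' : m 1
      · simp
      · simp [Polynomial.coeff_X_pow, eq_comm]
    · have : m 1 ≠ 1 := by omega
      simp [this, eps_pow_eq_zero h]
  | add p q hp hq => simp [hp, hq]

/-- The kernel of the jet map along `v = 0` is the square of the ideal `⟨v⟩` of this line. -/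
theorem mem_span_sq_iff (f : Poly) :
    f ∈ Ideal.span {(MvPolynomial.X 1 : Poly)} ^ 2 ↔ jetRight f = 0 := by
  rw [Ideal.span_singleton_pow, Ideal.mem_span_singleton]
  constructor
  · rintro ⟨g, rfl⟩
    rw [map_mul, map_pow, jetRight_X_one, DualNumber.eps_pow_two, zero_mul]
  · intro h
    rw [f.as_sum]
    refine Finset.dvd_sum fun m hm => ?_
    have h2 : 2 ≤ m 1 := by
      by_contra hlt
      apply MvPolynomial.mem_support_iff.1 hm
      have h0 : m 1 = 0 ∨ m 1 = 1 := by omega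
      rcases h0 with h0 | h0
      · have : m = Finsupp.single 0 (m 0) := by ext i; fin_cases i <;> simp [h0]
        rw [this, ← fst_jetRight_coeff, h]
        simp
      · have : m = Finsupp.single 0 (m 0) + Finsupp.single 1 1 := by
          ext i; fin_cases i <;> simp [h0]
        rw [this, ← snd_jetRight_coeff, h]
        simp
    rw [monomial_eq, MvPolynomial.smul_eq_C_mul]
    exact ((pow_dvd_pow _ h2).mul_left _).mul_left _

end Jets

/-! ### The ideal of an edge for `r = 1` -/

section EdgeJets

variable {X : Type*} [TopologicalSpace X] [CWComplex (Set.univ : Set X)]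
  {γ : Vertex X} {s : ℕ} {σ : ZMod s → Face X} {τ : ZMod s → Edge X}
  {ψ : Face X → X → Fin 2 → ℝ} {Φ : Transitions ψ 1} {a : ZMod s → Polynomial ℝ}

/-- For `r = 1` the ideal of `τ t` is the kernel of the map that sends a polynomial on either of
the two faces at `τ t` to its jet along `τ t`, in the coordinates of `σ (t + 1)`. -/
theorem exists_edgeJet (hs : IsVertexStar γ σ τ) (hΦ : IsCompatible Φ)
    (hg : IsGluedBy Φ γ σ τ a fun _ => -1) (t : ZMod s) :
    ∃ Θ : RingAt (edge (τ t)) →ₐ[ℝ] DualNumber (Polynomial ℝ),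
      (∀ x, x ∈ edgeIdeal Φ (τ t) ↔ Θ x = 0) ∧
      (∀ f, Θ (incl (hs.subset_left t) f) = jetLeft (a t) f) ∧
      (∀ f, Θ (incl (hs.subset_right t) f) = jetRight f) := by
  obtain ⟨φ, hφ, h0, h1⟩ := hg.map t
  obtain ⟨Θ, hker, hl, hr⟩ := exists_edgeHom hΦ (hs.face_ne t) (hs.inter t).symm (hs.eq_or_eq t)
    (hs.subset_left t) (hs.subset_right t) hφ
  have hI : idealOf ψ (σ (t + 1)) (face (σ t) ∩ face (σ (t + 1))) =
      Ideal.span {MvPolynomial.X 1} := by rw [hs.inter t, hg.ideal_right t]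
  have hmem : ∀ f, f ∈ idealOf ψ (σ (t + 1)) (face (σ t) ∩ face (σ (t + 1))) ^ (1 + 1) ↔
      jetRight f = 0 := fun f => by rw [hI, ← mem_span_sq_iff]
  let κ : JetRing ψ 1 (face (σ t) ∩ face (σ (t + 1))) (σ (t + 1)) →ₐ[ℝ]
      DualNumber (Polynomial ℝ) :=
    Ideal.Quotient.liftₐ _ jetRight fun f hf => (hmem f).1 hf
  have hκ : ∀ f, κ (Ideal.Quotient.mk _ f) = jetRight f := fun f => rfl
  have hκ0 : ∀ y, κ y = 0 → y = 0 := by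
    intro y hy
    obtain ⟨f, rfl⟩ := Ideal.Quotient.mk_surjective y
    exact Ideal.Quotient.eq_zero_iff_mem.2 ((hmem f).2 hy)
  have hφjet : (κ.comp φ).comp (Ideal.Quotient.mkₐ ℝ _) = jetLeft (a t) := by
    refine MvPolynomial.algHom_ext fun i => ?_
    change κ (φ (Ideal.Quotient.mk _ (MvPolynomial.X i))) = _
    fin_cases i
    · change κ (φ (Ideal.Quotient.mk _ (MvPolynomial.X 0))) = jetLeft (a t) (MvPolynomial.X 0)
      rw [h0, hκ]
      simp
    · change κ (φ (Ideal.Quotient.mk _ (MvPolynomial.X 1))) = jetLeft (a t) (MvPolynomial.X 1)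
      rw [h1, hκ]
      simp [TrivSqZeroExt.ext_iff]
  refine ⟨κ.comp Θ, fun x => ?_, fun f => ?_, fun f => ?_⟩
  · rw [hker, AlgHom.comp_apply]
    exact ⟨fun h => by rw [h, map_zero], hκ0 _⟩
  · rw [AlgHom.comp_apply, hl]
    exact DFunLike.congr_fun hφjet f
  · rw [AlgHom.comp_apply, hr, hκ]

theorem incl_sub_incl_mem_edgeIdeal (hs : IsVertexStar γ σ τ) (hΦ : IsCompatible Φ)
    (hg : IsGluedBy Φ γ σ τ a fun _ => -1) (t : ZMod s) (f g : Poly)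
    (h : jetLeft (a t) f = jetRight g) :
    incl (hs.subset_left t) f - incl (hs.subset_right t) g ∈ edgeIdeal Φ (τ t) := by
  obtain ⟨Θ, hker, hl, hr⟩ := exists_edgeJet hs hΦ hg t
  rw [hker, map_sub, hl, hr, h, sub_self]

/-- `Q(τ t)` is isomorphic to the space of the jets of polynomials on the two faces. -/
theorem finrank_edge_eq (hs : IsVertexStar γ σ τ) (hΦ : IsCompatible Φ)
    (hg : IsGluedBy Φ γ σ τ a fun _ => -1) (t : ZMod s) (W : Submodule ℝ Poly) :
    Module.finrank ℝ (QSpace W (edgeIdeal Φ (τ t))) =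
      Module.finrank ℝ (W.map (jetLeft (a t)).toLinearMap ⊔ W.map jetRight.toLinearMap :
        Submodule ℝ (DualNumber (Polynomial ℝ))) := by
  obtain ⟨Θ, hker, hl, hr⟩ := exists_edgeJet hs hΦ hg t
  have hinj := QSpace.lift_injective W _ Θ.toLinearMap hker
  rw [← LinearMap.finrank_range_of_inj hinj, QSpace.range_lift]
  have hl' : Θ.toLinearMap ∘ₗ (incl (hs.subset_left t)).toLinearMap =
      (jetLeft (a t)).toLinearMap := LinearMap.ext hl
  have hr' : Θ.toLinearMap ∘ₗ (incl (hs.subset_right t)).toLinearMap =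
      jetRight.toLinearMap := LinearMap.ext hr
  have : ⨆ ρ : FacesAt (edge (τ t)), W.map (Θ.toLinearMap ∘ₗ (incl ρ.2).toLinearMap) =
      W.map (jetLeft (a t)).toLinearMap ⊔ W.map jetRight.toLinearMap := by
    apply le_antisymm
    · refine iSup_le fun ⟨ρ, hρ⟩ => ?_
      rcases hs.eq_or_eq t ρ hρ with rfl | rfl
      · rw [hl']; exact le_sup_left
      · rw [hr']; exact le_sup_right
    · refine sup_le ?_ ?_
      · rw [← hl']
        exact le_iSup (fun ρ : FacesAt (edge (τ t)) =>
          W.map (Θ.toLinearMap ∘ₗ (incl ρ.2).toLinearMap)) ⟨_, hs.subset_left t⟩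
      · rw [← hr']
        exact le_iSup (fun ρ : FacesAt (edge (τ t)) =>
          W.map (Θ.toLinearMap ∘ₗ (incl ρ.2).toLinearMap)) ⟨_, hs.subset_right t⟩
  rw [this]

end EdgeJets

/-! ### The dimension of `Q` at an edge -/

section EdgeDimension

theorem monomial_mem_of_mem {N : Set (Fin 2 →₀ ℕ)} {m : Fin 2 →₀ ℕ} (hm : m ∈ N) :
    (MvPolynomial.X 0 ^ m 0 * MvPolynomial.X 1 ^ m 1 : Poly) ∈
      MvPolynomial.restrictSupport ℝ N := by
  have := (MvPolynomial.monomial_mem_restrictSupport ℝ (r := (1 : ℝ))).2 (Or.inl hm)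
  rwa [monomial_eq, one_smul] at this

/-- A set `N` of exponents `(i, j)` with the row `j = 0` equal to `i ≤ d` and the row `j = 1` equal
to `i < n`, and likewise for the columns. -/
structure IsWindow (N : Set (Fin 2 →₀ ℕ)) (d n : ℕ) : Prop where
  zero_le : ∀ m ∈ N, m 0 ≤ d
  one_le : ∀ m ∈ N, m 1 ≤ d
  zero_lt : ∀ m ∈ N, m 1 = 1 → m 0 < n
  one_lt : ∀ m ∈ N, m 0 = 1 → m 1 < n
  row_zero_mem : ∀ i ≤ d, Finsupp.single 0 i ∈ N
  column_zero_mem : ∀ j ≤ d, Finsupp.single 1 j ∈ N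
  row_one_mem : ∀ i < n, Finsupp.single 0 i + Finsupp.single 1 1 ∈ N

/-- The monomial exponents of total degree at most `d`. -/
def totalExponents (d : ℕ) : Set (Fin 2 →₀ ℕ) := {m | (m.sum fun _ e => e) ≤ d}

/-- The monomial exponents of bidegree at most `(d, d)`. -/
def biExponents (d : ℕ) : Set (Fin 2 →₀ ℕ) := {m | ∀ i, m i ≤ d}

theorem isWindow_totalDeg (d : ℕ) :
    IsWindow (totalExponents d) d d := by
  have h : ∀ m : Fin 2 →₀ ℕ, (m.sum fun _ e => e) = m 0 + m 1 := fun m => by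
    rw [Finsupp.sum_fintype _ _ (by simp), Fin.sum_univ_two]
  constructor <;> simp only [totalExponents, Set.mem_ofPred_eq, h] <;> intros <;> (try simp) <;>
    omega

theorem isWindow_biDeg {d : ℕ} (hd : 1 ≤ d) :
    IsWindow (biExponents d) d (d + 1) := by
  constructor <;> simp only [biExponents, Set.mem_ofPred_eq, Fin.forall_fin_two] <;> intros <;>
    (try simp) <;> omega

open Polynomial in
/-- The sum of `P` and `ε Q` in `ℝ[X][ε]`. -/
def dualSum (P Q : Submodule ℝ ℝ[X]) : Submodule ℝ (DualNumber ℝ[X]) :=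
  P.map (TrivSqZeroExt.inlAlgHom ℝ ℝ[X] ℝ[X]).toLinearMap ⊔
    Q.map ((TrivSqZeroExt.inrHom ℝ[X] ℝ[X]).restrictScalars ℝ)

open Polynomial in
theorem finrank_dualSum (P Q : Submodule ℝ ℝ[X]) [FiniteDimensional ℝ P] [FiniteDimensional ℝ Q] :
    Module.finrank ℝ (dualSum P Q) = Module.finrank ℝ P + Module.finrank ℝ Q := by
  have h := Submodule.finrank_sup_add_finrank_inf_eq
    (P.map (TrivSqZeroExt.inlAlgHom ℝ ℝ[X] ℝ[X]).toLinearMap)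
    (Q.map ((TrivSqZeroExt.inrHom ℝ[X] ℝ[X]).restrictScalars ℝ))
  have hbot : P.map (TrivSqZeroExt.inlAlgHom ℝ ℝ[X] ℝ[X]).toLinearMap ⊓
      Q.map ((TrivSqZeroExt.inrHom ℝ[X] ℝ[X]).restrictScalars ℝ) = ⊥ := by
    rw [eq_bot_iff]
    rintro _ ⟨⟨p, -, rfl⟩, q, -, h⟩
    have h' : TrivSqZeroExt.inr q = (TrivSqZeroExt.inl p : DualNumber ℝ[X]) := h
    have : p = 0 := by simpa using (congrArg TrivSqZeroExt.fst h').symm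
    subst this
    simp
  rw [hbot, finrank_bot, add_zero] at h
  rw [dualSum, h, ← (Submodule.equivMapOfInjective _ TrivSqZeroExt.inl_injective P).finrank_eq,
    ← (Submodule.equivMapOfInjective _ TrivSqZeroExt.inr_injective Q).finrank_eq]

open Polynomial in
theorem inl_mem_dualSum {P Q : Submodule ℝ ℝ[X]} {p : ℝ[X]} (hp : p ∈ P) :
    (TrivSqZeroExt.inl p : DualNumber ℝ[X]) ∈ dualSum P Q :=
  Submodule.mem_sup_left ⟨p, hp, rfl⟩

open Polynomial in
theorem inr_mem_dualSum {P Q : Submodule ℝ ℝ[X]} {q : ℝ[X]} (hq : q ∈ Q) :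
    (TrivSqZeroExt.inr q : DualNumber ℝ[X]) ∈ dualSum P Q :=
  Submodule.mem_sup_right ⟨q, hq, rfl⟩

open Polynomial in
theorem jetRight_pow_zero (i : ℕ) :
    jetRight (MvPolynomial.X 0 ^ i) = TrivSqZeroExt.inl (X ^ i) := by
  rw [map_pow, jetRight_X_zero, TrivSqZeroExt.inl_pow]

open Polynomial in
theorem jetRight_pow_one (i : ℕ) :
    jetRight (MvPolynomial.X 0 ^ i * MvPolynomial.X 1) = TrivSqZeroExt.inr (X ^ i) := by
  rw [map_mul, jetRight_pow_zero, jetRight_X_one]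
  simp [TrivSqZeroExt.ext_iff]

open Polynomial in
theorem jetLeft_one_pow (a : ℝ[X]) (j : ℕ) : jetLeft a (MvPolynomial.X 1 ^ j) =
    TrivSqZeroExt.inl (X ^ j) + (j : ℝ) • TrivSqZeroExt.inr (a * X ^ (j - 1)) := by
  rw [map_pow, jetLeft_X_one]
  refine TrivSqZeroExt.ext (by simp) ?_
  rw [TrivSqZeroExt.snd_pow]
  simp [smul_eq_C_mul, mul_comm]

open Polynomial in
theorem jetLeft_zero_mul_pow (a : ℝ[X]) (j : ℕ) :
    jetLeft a (MvPolynomial.X 0 * MvPolynomial.X 1 ^ j) = -TrivSqZeroExt.inr (X ^ j) := by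
  rw [map_mul, jetLeft_one_pow, jetLeft_X_zero]
  simp [TrivSqZeroExt.ext_iff]

open Polynomial in
/-- The polynomials with exponents in a window on the two faces at an edge have the first jets
`p + ε q` with `deg p ≤ d` and `q ∈ ℝ[X]_{<n} + a ℝ[X]_{<d}`. -/
theorem map_jetLeft_sup_map_jetRight {N : Set (Fin 2 →₀ ℕ)} {d n : ℕ} (hN : IsWindow N d n)
    (a : ℝ[X]) :
    (MvPolynomial.restrictSupport ℝ N).map (jetLeft a).toLinearMap ⊔
      (MvPolynomial.restrictSupport ℝ N).map jetRight.toLinearMap =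
    dualSum (degreeLT ℝ (d + 1)) (degreeLT ℝ n ⊔ (degreeLT ℝ d).map (LinearMap.mulLeft ℝ a)) := by
  have hpow : ∀ {i k : ℕ}, i < k → (X ^ i : ℝ[X]) ∈ degreeLT ℝ k := fun h => by
    rw [mem_degreeLT, degree_X_pow]
    exact_mod_cast h
  apply le_antisymm
  · rw [MvPolynomial.restrictSupport_eq_span, Submodule.map_span, Submodule.map_span]
    refine sup_le (Submodule.span_le.2 ?_) (Submodule.span_le.2 ?_)
    · rintro _ ⟨_, ⟨m, hm, rfl⟩, rfl⟩
      change jetLeft a (MvPolynomial.monomial m 1) ∈ dualSum _ _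
      rw [monomial_eq, one_smul]
      rcases Nat.lt_or_ge (m 0) 2 with h | h
      · interval_cases h' : m 0
        · rw [pow_zero, one_mul, jetLeft_one_pow]
          refine Submodule.add_mem _ (inl_mem_dualSum (hpow (Nat.lt_succ_of_le (hN.one_le m hm))))
            ?_
          rcases Nat.eq_zero_or_pos (m 1) with h0 | h0
          · rw [h0, Nat.cast_zero, zero_smul]
            exact Submodule.zero_mem _
          · refine Submodule.smul_mem _ _ (inr_mem_dualSum (Submodule.mem_sup_right
              ⟨X ^ (m 1 - 1), hpow ?_, rfl⟩))
            have := hN.one_le m hm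
            omega
        · rw [pow_one, jetLeft_zero_mul_pow]
          exact Submodule.neg_mem _ (inr_mem_dualSum (Submodule.mem_sup_left
            (hpow (hN.one_lt m hm h'))))
      · rw [map_mul, map_pow, jetLeft_X_zero, neg_pow, eps_pow_eq_zero h, mul_zero, zero_mul]
        exact Submodule.zero_mem _
    · rintro _ ⟨_, ⟨m, hm, rfl⟩, rfl⟩
      change jetRight (MvPolynomial.monomial m 1) ∈ dualSum _ _
      rw [monomial_eq, one_smul]
      rcases Nat.lt_or_ge (m 1) 2 with h | h
      · interval_cases h' : m 1
        · rw [pow_zero, mul_one, jetRight_pow_zero]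
          exact inl_mem_dualSum (hpow (Nat.lt_succ_of_le (hN.zero_le m hm)))
        · rw [pow_one, jetRight_pow_one]
          exact inr_mem_dualSum (Submodule.mem_sup_left (hpow (hN.zero_lt m hm h')))
      · rw [map_mul, map_pow jetRight (MvPolynomial.X 1), jetRight_X_one, eps_pow_eq_zero h,
          mul_zero]
        exact Submodule.zero_mem _
  · have hinl : ∀ i ≤ d, (TrivSqZeroExt.inl (X ^ i) : DualNumber ℝ[X]) ∈
        (MvPolynomial.restrictSupport ℝ N).map jetRight.toLinearMap := by
      intro i hi
      rw [← jetRight_pow_zero]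
      refine Submodule.mem_map_of_mem (f := jetRight.toLinearMap) ?_
      simpa using monomial_mem_of_mem (hN.row_zero_mem i hi)
    refine sup_le ?_ ?_
    · classical
      rw [degreeLT_eq_span_X_pow, Submodule.map_span]
      refine Submodule.span_le.2 ?_
      rintro _ ⟨p, hp, rfl⟩
      obtain ⟨i, hi, rfl⟩ := Finset.mem_image.1 hp
      exact Submodule.mem_sup_right (hinl i (Nat.le_of_lt_succ (Finset.mem_range.1 hi)))
    · classical
      rw [degreeLT_eq_span_X_pow, degreeLT_eq_span_X_pow, Submodule.map_sup, Submodule.map_span,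
        Submodule.map_span, Submodule.map_span]
      refine sup_le (Submodule.span_le.2 ?_) (Submodule.span_le.2 ?_)
      · rintro _ ⟨p, hp, rfl⟩
        obtain ⟨i, hi, rfl⟩ := Finset.mem_image.1 hp
        refine Submodule.mem_sup_right ?_
        change (TrivSqZeroExt.inr (X ^ i) : DualNumber ℝ[X]) ∈ _
        rw [← jetRight_pow_one]
        refine Submodule.mem_map_of_mem (f := jetRight.toLinearMap) ?_
        simpa using monomial_mem_of_mem (hN.row_one_mem i (Finset.mem_range.1 hi))
      · rintro _ ⟨_, ⟨p, hp, rfl⟩, rfl⟩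
        obtain ⟨i, hi, rfl⟩ := Finset.mem_image.1 hp
        have hi' : i + 1 ≤ d := Finset.mem_range.1 hi
        change (TrivSqZeroExt.inr (a * X ^ i) : DualNumber ℝ[X]) ∈ _
        -- `ε a u ^ i` is a combination of the jets of `v ^ (i + 1)` on one face and of
        -- `u ^ (i + 1)` on the other
        have h1 : (TrivSqZeroExt.inr (a * X ^ i) : DualNumber ℝ[X]) =
            ((i + 1 : ℕ) : ℝ)⁻¹ • (jetLeft a (MvPolynomial.X 1 ^ (i + 1)) -
              TrivSqZeroExt.inl (X ^ (i + 1))) := by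
          rw [jetLeft_one_pow, add_sub_cancel_left, smul_smul, inv_mul_cancel₀ (by positivity),
            one_smul, Nat.add_sub_cancel]
        rw [h1]
        refine Submodule.smul_mem _ _ (Submodule.sub_mem _ (Submodule.mem_sup_left
          (Submodule.mem_map_of_mem (f := (jetLeft a).toLinearMap) ?_))
          (Submodule.mem_sup_right (hinl _ hi')))
        simpa using monomial_mem_of_mem (hN.column_zero_mem (i + 1) hi')

open Polynomial in
theorem finrank_degreeLT (n : ℕ) : Module.finrank ℝ (degreeLT ℝ n) = n := by
  rw [(degreeLTEquiv ℝ n).finrank_eq, Module.finrank_fin_fun]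

open Polynomial in
instance (n : ℕ) : FiniteDimensional ℝ (degreeLT ℝ n) :=
  Module.Finite.equiv (degreeLTEquiv ℝ n).symm

open Polynomial in
/-- By division with remainder, `ℝ[X]_{<n} + a ℝ[X]_{<d}` contains all polynomials of degree less
than `d + deg a` if `deg a ≤ n`. -/
theorem degreeLT_sup_mul {a : ℝ[X]} (ha : a ≠ 0) {d n : ℕ} (h1 : a.natDegree ≤ n)
    (h2 : n ≤ d + a.natDegree) :
    degreeLT ℝ n ⊔ (degreeLT ℝ d).map (LinearMap.mulLeft ℝ a) =
      degreeLT ℝ (d + a.natDegree) := by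
  have hdeg := degree_eq_natDegree ha
  apply le_antisymm
  · refine sup_le (degreeLT_mono h2) ?_
    rintro _ ⟨p, hp, rfl⟩
    rcases eq_or_ne p 0 with rfl | hp0
    · simp
    rw [SetLike.mem_coe, mem_degreeLT, degree_eq_natDegree hp0] at hp
    have hp' : p.natDegree < d := by exact_mod_cast hp
    change a * p ∈ _
    rw [mem_degreeLT, degree_mul, hdeg, degree_eq_natDegree hp0]
    norm_cast
    omega
  · intro p hp
    rw [← EuclideanDomain.div_add_mod p a]
    refine Submodule.add_mem _ (Submodule.mem_sup_right ⟨p / a, ?_, rfl⟩)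
      (Submodule.mem_sup_left ?_)
    · rcases lt_or_ge p.degree a.degree with h | h
      · rw [(Polynomial.div_eq_zero_iff ha).2 h]
        exact Submodule.zero_mem _
      · have hq := degree_add_div ha h
        rcases eq_or_ne (p / a) 0 with h0 | h0
        · rw [h0]
          exact Submodule.zero_mem _
        · rw [mem_degreeLT, ← hq, hdeg, degree_eq_natDegree h0] at hp
          rw [SetLike.mem_coe, mem_degreeLT, degree_eq_natDegree h0]
          norm_cast at hp ⊢
          omega
    · rw [mem_degreeLT]
      refine (EuclideanDomain.mod_lt p ha).trans_le ?_
      rw [hdeg]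
      exact_mod_cast h1

end EdgeDimension

section EdgeDimensionStar

variable {X : Type*} [TopologicalSpace X] [CWComplex (Set.univ : Set X)]
  {γ : Vertex X} {s : ℕ} {σ : ZMod s → Face X} {τ : ZMod s → Edge X}
  {ψ : Face X → X → Fin 2 → ℝ} {Φ : Transitions ψ 1} {a : ZMod s → Polynomial ℝ}

theorem finrank_edge_of_ne_zero (hs : IsVertexStar γ σ τ) (hΦ : IsCompatible Φ)
    (hg : IsGluedBy Φ γ σ τ a fun _ => -1) {N : Set (Fin 2 →₀ ℕ)} {d n : ℕ}
    (hN : IsWindow N d n) (t : ZMod s) (ha : a t ≠ 0) (h1 : (a t).natDegree ≤ n)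
    (h2 : n ≤ d + (a t).natDegree) :
    Module.finrank ℝ (QSpace (MvPolynomial.restrictSupport ℝ N) (edgeIdeal Φ (τ t))) =
      2 * d + (a t).natDegree + 1 := by
  rw [finrank_edge_eq hs hΦ hg, map_jetLeft_sup_map_jetRight hN, finrank_dualSum,
    degreeLT_sup_mul ha h1 h2, finrank_degreeLT, finrank_degreeLT]
  omega

theorem finrank_edge_of_eq_zero (hs : IsVertexStar γ σ τ) (hΦ : IsCompatible Φ)
    (hg : IsGluedBy Φ γ σ τ a fun _ => -1) {N : Set (Fin 2 →₀ ℕ)} {d n : ℕ}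
    (hN : IsWindow N d n) (t : ZMod s) (ha : a t = 0) :
    Module.finrank ℝ (QSpace (MvPolynomial.restrictSupport ℝ N) (edgeIdeal Φ (τ t))) =
      d + 1 + n := by
  have h0 : (Polynomial.degreeLT ℝ d).map (LinearMap.mulLeft ℝ (0 : Polynomial ℝ)) = ⊥ := by
    rw [LinearMap.mulLeft_zero_eq_zero, Submodule.map_zero]
  rw [finrank_edge_eq hs hΦ hg, map_jetLeft_sup_map_jetRight hN, finrank_dualSum, ha, h0,
    sup_bot_eq, finrank_degreeLT, finrank_degreeLT]

end EdgeDimensionStar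

/-! ### Reduction to the polynomials `1`, `u`, `v`, `uv` at the vertex -/

section VertexReduction

/-- The space `W` contains the polynomials that occur when `1`, `u`, `v`, `uv` and `v²` are carried
over an edge with gluing data `a`. -/
structure IsAmple (W : Submodule ℝ Poly) (a : Polynomial ℝ) : Prop where
  one_mem : 1 ∈ W
  u_mem : MvPolynomial.X 0 ∈ W
  v_mem : MvPolynomial.X 1 ∈ W
  uv_mem : MvPolynomial.X 0 * MvPolynomial.X 1 ∈ W
  v_sq_mem : MvPolynomial.X 1 ^ 2 ∈ W
  v_image_mem :
    MvPolynomial.X 0 + MvPolynomial.X 1 * Polynomial.aeval (MvPolynomial.X 0 : Poly) a ∈ W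
  v_sq_image_mem : MvPolynomial.X 0 ^ 2 + MvPolynomial.X 1 *
    Polynomial.aeval (MvPolynomial.X 0 : Poly) (2 * Polynomial.X * a) ∈ W

variable {s : ℕ} {M : Type*} [AddCommGroup M] [Module ℝ M] {N : Set (Fin 2 →₀ ℕ)}
  {F : ZMod s → Poly →ₗ[ℝ] M} {a : ZMod s → Polynomial ℝ}

/-- If the maps `F t` identify the polynomials that agree across the edges, then they vanish on
`u²` and on `v²`, so that only the coefficients of `1`, `u`, `v` and `uv` count. -/
theorem map_eq_of_joins
    (hF : ∀ t, ∀ f ∈ MvPolynomial.restrictSupport ℝ N, ∀ g ∈ MvPolynomial.restrictSupport ℝ N,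
      jetLeft (a t) f = jetRight g → F t f = F (t + 1) g) (t : ZMod s) (f : Poly)
    (hf : f ∈ MvPolynomial.restrictSupport ℝ N) :
    F t f = (jetRight f).fst.coeff 0 • F t 1 + (jetRight f).fst.coeff 1 • F t (MvPolynomial.X 0) +
      (jetRight f).snd.coeff 0 • F t (MvPolynomial.X 1) +
      (jetRight f).snd.coeff 1 • F t (MvPolynomial.X 0 * MvPolynomial.X 1) := by
  rw [MvPolynomial.restrictSupport_eq_span] at hf
  induction hf using Submodule.span_induction with
  | mem f hf =>
    obtain ⟨m, hm, rfl⟩ := hf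
    have hmem : (MvPolynomial.monomial m 1 : Poly) ∈ MvPolynomial.restrictSupport ℝ N :=
      (MvPolynomial.monomial_mem_restrictSupport ℝ).2 (Or.inl hm)
    have h0 := Submodule.zero_mem (MvPolynomial.restrictSupport ℝ N)
    simp only [jetRight_monomial]
    rcases Nat.lt_or_ge (m 1) 2 with h1 | h1
    · rcases Nat.lt_or_ge (m 0) 2 with h2 | h2
      · simp only [monomial_eq]
        interval_cases h1' : m 1 <;> interval_cases h2' : m 0 <;>
          simp [Polynomial.coeff_X, Polynomial.coeff_one]
      · have hz : F t (MvPolynomial.monomial m 1) = 0 := by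
          rw [hF t _ hmem 0 h0, map_zero]
          rw [map_zero, monomial_eq, map_smul, map_mul, map_pow, jetLeft_X_zero, neg_pow,
            eps_pow_eq_zero h2, mul_zero, zero_mul, smul_zero]
        have h3 : m 0 ≠ 0 := by omega
        have h4 : m 0 ≠ 1 := by omega
        rw [hz]
        interval_cases h1' : m 1 <;> simp [Polynomial.coeff_X_pow, h3.symm, h4.symm]
    · obtain ⟨t', rfl⟩ : ∃ t', t = t' + 1 := ⟨t - 1, by ring⟩
      rw [eps_pow_eq_zero h1, ← hF t' 0 h0 _ hmem]
      · simp
      · rw [map_zero, jetRight_monomial, eps_pow_eq_zero h1, mul_zero, smul_zero]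
  | zero => simp
  | add f g _ _ hf hg =>
    rw [map_add, hf, hg]
    simp only [map_add, TrivSqZeroExt.fst_add, TrivSqZeroExt.snd_add, Polynomial.coeff_add]
    module
  | smul c f _ hf =>
    rw [map_smul, hf]
    simp only [map_smul, TrivSqZeroExt.fst_smul, TrivSqZeroExt.snd_smul, Polynomial.coeff_smul,
      smul_eq_mul]
    module

/-- If the maps `F t` identify the polynomials that agree across the edges, then their images lie
in the span of the images of `1`, `v_0`, `v_1` and `u_0 v_0`, the last of which is zero if the
`a t` have a common non-zero constant term. -/
theorem exists_finrank_le [NeZero s] {c : ℝ} (hc : ∀ t, (a t).coeff 0 = c)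
    (hW : ∀ t, IsAmple (MvPolynomial.restrictSupport ℝ N) (a t))
    (hF : ∀ t, ∀ f ∈ MvPolynomial.restrictSupport ℝ N, ∀ g ∈ MvPolynomial.restrictSupport ℝ N,
      jetLeft (a t) f = jetRight g → F t f = F (t + 1) g) :
    ∃ K : Submodule ℝ M, FiniteDimensional ℝ K ∧ Module.finrank ℝ K ≤ 4 ∧
      (c ≠ 0 → Module.finrank ℝ K ≤ 3) ∧
      ∀ t, ∀ f ∈ MvPolynomial.restrictSupport ℝ N, F t f ∈ K := by
  have hone : ∀ t, F t 1 = F (t + 1) 1 := fun t =>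
    hF t _ (hW t).one_mem _ (hW t).one_mem (by simp)
  have hu : ∀ t, F t (MvPolynomial.X 0) = -F (t + 1) (MvPolynomial.X 1) := fun t => by
    rw [← map_neg]
    exact hF t _ (hW t).u_mem _ (Submodule.neg_mem _ (hW t).v_mem) (by simp)
  have huv : ∀ t, F t (MvPolynomial.X 0 * MvPolynomial.X 1) =
      -F (t + 1) (MvPolynomial.X 0 * MvPolynomial.X 1) := fun t => by
    rw [← map_neg]
    refine hF t _ (hW t).uv_mem _ (Submodule.neg_mem _ (hW t).uv_mem) ?_
    simp [TrivSqZeroExt.ext_iff]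
  have hv : ∀ t, F (t + 1 + 1) (MvPolynomial.X 1) = c • F (t + 1) (MvPolynomial.X 1) +
      (a t).coeff 1 • F (t + 1) (MvPolynomial.X 0 * MvPolynomial.X 1) -
        F t (MvPolynomial.X 1) := fun t => by
    have h1 := hF t _ (hW t).v_mem _ (hW t).v_image_mem
      (by simp [TrivSqZeroExt.ext_iff])
    rw [map_eq_of_joins hF _ _ (hW t).v_image_mem, hu (t + 1)] at h1
    simp [hc] at h1
    rw [h1]
    abel
  have hcuv : ∀ t, c • F (t + 1) (MvPolynomial.X 0 * MvPolynomial.X 1) = 0 := fun t => by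
    have h1 := hF t _ (hW t).v_sq_mem _ (hW t).v_sq_image_mem (by
      simp [TrivSqZeroExt.ext_iff, pow_two]; ring)
    rw [map_eq_of_joins hF _ _ (hW t).v_sq_image_mem] at h1
    have h2 : F t (MvPolynomial.X 1 ^ 2) = 0 := by
      rw [map_eq_of_joins hF _ _ (hW t).v_sq_mem]
      simp
    rw [h2] at h1
    have h3 : (2 * Polynomial.X * a t).coeff 0 = 0 := by simp [Polynomial.mul_coeff_zero]
    have h4 : (2 * Polynomial.X * a t).coeff 1 = 2 * c := by
      rw [mul_comm 2, mul_assoc, Polynomial.coeff_X_mul, Polynomial.mul_coeff_zero, hc]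
      simp
    simp [h3, h4, Polynomial.coeff_X_pow, mul_smul] at h1
    exact (smul_eq_zero.1 h1.symm).resolve_left two_ne_zero
  let b : Fin 4 → M := ![F 0 1, F 0 (MvPolynomial.X 1), F 1 (MvPolynomial.X 1),
    F 0 (MvPolynomial.X 0 * MvPolynomial.X 1)]
  have hb : ∀ i, b i ∈ Submodule.span ℝ (Set.range b) := fun i =>
    Submodule.subset_span ⟨i, rfl⟩
  have hind : ∀ n : ℕ, F n 1 ∈ Submodule.span ℝ (Set.range b) ∧
      F n (MvPolynomial.X 0 * MvPolynomial.X 1) ∈ Submodule.span ℝ (Set.range b) ∧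
      F n (MvPolynomial.X 1) ∈ Submodule.span ℝ (Set.range b) ∧
      F (n + 1) (MvPolynomial.X 1) ∈ Submodule.span ℝ (Set.range b) := by
    intro n
    induction n with
    | zero => simpa using ⟨hb 0, hb 3, hb 1, hb 2⟩
    | succ n ih =>
      obtain ⟨h1, h2, h3, h4⟩ := ih
      rw [huv] at h2
      have h2' := neg_mem_iff.1 h2
      push_cast
      refine ⟨by rwa [← hone], h2', h4, ?_⟩
      rw [hv]
      exact Submodule.sub_mem _ (Submodule.add_mem _ (Submodule.smul_mem _ _ h4)
        (Submodule.smul_mem _ _ h2')) h3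
  have hall : ∀ t, F t 1 ∈ Submodule.span ℝ (Set.range b) ∧
      F t (MvPolynomial.X 0 * MvPolynomial.X 1) ∈ Submodule.span ℝ (Set.range b) ∧
      F t (MvPolynomial.X 1) ∈ Submodule.span ℝ (Set.range b) := by
    intro t
    have h := hind t.val
    rw [ZMod.natCast_zmod_val] at h
    exact ⟨h.1, h.2.1, h.2.2.1⟩
  refine ⟨Submodule.span ℝ (Set.range b), FiniteDimensional.span_of_finite ℝ (Set.finite_range b),
    (finrank_range_le_card b).trans (by simp), fun hc0 => ?_, fun t f hf => ?_⟩
  · have h0 : F 0 (MvPolynomial.X 0 * MvPolynomial.X 1) = 0 := by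
      rcases smul_eq_zero.1 (hcuv (-1)) with h | h
      · exact absurd h hc0
      · simpa using h
    have hle : Submodule.span ℝ (Set.range b) ≤ Submodule.span ℝ (Set.range
        ![F 0 1, F 0 (MvPolynomial.X 1), F 1 (MvPolynomial.X 1)]) := by
      refine Submodule.span_le.2 ?_
      rintro _ ⟨i, rfl⟩
      fin_cases i
      · exact Submodule.subset_span ⟨0, rfl⟩
      · exact Submodule.subset_span ⟨1, rfl⟩
      · exact Submodule.subset_span ⟨2, rfl⟩
      · change F 0 _ ∈ _
        rw [h0]
        exact Submodule.zero_mem _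
    have : FiniteDimensional ℝ (Submodule.span ℝ (Set.range
        ![F 0 1, F 0 (MvPolynomial.X 1), F 1 (MvPolynomial.X 1)])) :=
      FiniteDimensional.span_of_finite ℝ (Set.finite_range _)
    exact (Submodule.finrank_mono hle).trans ((finrank_range_le_card _).trans (by simp))
  · obtain ⟨h1, h2, h3⟩ := hall t
    rw [map_eq_of_joins hF t f hf, hu]
    exact Submodule.add_mem _ (Submodule.add_mem _ (Submodule.add_mem _
      (Submodule.smul_mem _ _ h1) (Submodule.smul_mem _ _ (Submodule.neg_mem _ (hall _).2.2)))
      (Submodule.smul_mem _ _ h3)) (Submodule.smul_mem _ _ h2)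

theorem isAmple_univ (a : Polynomial ℝ) :
    IsAmple (MvPolynomial.restrictSupport ℝ Set.univ) a := by
  rw [MvPolynomial.restrictSupport_univ]
  constructor <;> exact trivial

theorem IsWindow.isAmple {d n : ℕ} (hN : IsWindow N d n) (hd : 2 ≤ d) (hn : 4 ≤ n)
    {a : Polynomial ℝ} (ha : a.natDegree ≤ 2) : IsAmple (MvPolynomial.restrictSupport ℝ N) a := by
  have hrow : ∀ i ≤ d, (MvPolynomial.X 0 ^ i : Poly) ∈ MvPolynomial.restrictSupport ℝ N :=
    fun i hi => by simpa using monomial_mem_of_mem (hN.row_zero_mem i hi)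
  have hcol : ∀ i ≤ d, (MvPolynomial.X 1 ^ i : Poly) ∈ MvPolynomial.restrictSupport ℝ N :=
    fun i hi => by simpa using monomial_mem_of_mem (hN.column_zero_mem i hi)
  have hone : ∀ p : Polynomial ℝ, p.natDegree < n →
      MvPolynomial.X 1 * Polynomial.aeval (MvPolynomial.X 0 : Poly) p ∈
        MvPolynomial.restrictSupport ℝ N := by
    intro p hp
    rw [Polynomial.aeval_eq_sum_range' hp, Finset.mul_sum]
    refine Submodule.sum_mem _ fun i hi => ?_
    rw [mul_smul_comm, mul_comm]
    exact Submodule.smul_mem _ _ (by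
      simpa using monomial_mem_of_mem (hN.row_one_mem i (Finset.mem_range.1 hi)))
  constructor
  · simpa using hrow 0 (by omega)
  · simpa using hrow 1 (by omega)
  · simpa using hcol 1 (by omega)
  · simpa using monomial_mem_of_mem (hN.row_one_mem 1 (by omega))
  · exact hcol 2 hd
  · refine Submodule.add_mem _ (by simpa using hrow 1 (by omega)) (hone _ (by omega))
  · refine Submodule.add_mem _ (hrow 2 hd) (hone _ ?_)
    have h1 : (2 * Polynomial.X * a).natDegree ≤ 1 + a.natDegree := by
      refine Polynomial.natDegree_mul_le.trans (Nat.add_le_add_right ?_ _)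
      exact (Polynomial.natDegree_C_mul_le 2 Polynomial.X).trans Polynomial.natDegree_X_le
    omega

end VertexReduction

/-! ### The dimension of `Q` at the vertex -/

section VertexDimension

variable {X : Type*} [TopologicalSpace X] [CWComplex (Set.univ : Set X)]
  {γ : Vertex X} {s : ℕ} {σ : ZMod s → Face X} {τ : ZMod s → Edge X}
  {ψ : Face X → X → Fin 2 → ℝ} {Φ : Transitions ψ 1} {a : ZMod s → Polynomial ℝ}

/-- The dimension of `Q(γ)` is at most four, and at most three if the `a t` have a common non-zero
constant term: `R(γ) / I(γ)` is spanned by `1`, `v_0`, `v_1` and `v_0 v_1`. -/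
theorem finrank_vertex_le [NeZero s] (hs : IsVertexStar γ σ τ) (hΦ : IsCompatible Φ)
    (hg : IsGluedBy Φ γ σ τ a fun _ => -1) {c : ℝ} (hc : ∀ t, (a t).coeff 0 = c)
    (W : Submodule ℝ Poly) :
    Module.finrank ℝ (QSpace W (vertIdeal Φ γ)) ≤ 4 ∧
      (c ≠ 0 → Module.finrank ℝ (QSpace W (vertIdeal Φ γ)) ≤ 3) := by
  let Θ : RingAt (vert γ) →ₗ[ℝ] RingAt (vert γ) ⧸ vertIdeal Φ γ :=
    (Ideal.Quotient.mkₐ ℝ (vertIdeal Φ γ)).toLinearMap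
  have hΘ : ∀ x, x ∈ vertIdeal Φ γ ↔ Θ x = 0 := fun x => Ideal.Quotient.eq_zero_iff_mem.symm
  let F : ZMod s → Poly →ₗ[ℝ] RingAt (vert γ) ⧸ vertIdeal Φ γ :=
    fun t => Θ ∘ₗ (incl (hs.vert_subset t)).toLinearMap
  obtain ⟨K, hfin, h4, h3, hK⟩ := exists_finrank_le (F := F) (N := Set.univ) hc
    (fun t => isAmple_univ (a t)) (fun t f _ g _ h => by
      have h1 := Ideal.mem_map_of_mem (res (hs.mem t))
        (incl_sub_incl_mem_edgeIdeal hs hΦ hg t f g h)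
      rw [map_sub, res_incl, res_incl] at h1
      have h2 := (hΘ _).1 (map_edgeIdeal_le Φ (hs.mem t) h1)
      rw [map_sub, sub_eq_zero] at h2
      exact h2)
  have hle : Module.finrank ℝ (QSpace W (vertIdeal Φ γ)) ≤ Module.finrank ℝ K := by
    rw [← LinearMap.finrank_range_of_inj (QSpace.lift_injective W _ Θ hΘ), QSpace.range_lift]
    refine Submodule.finrank_mono (iSup_le fun ⟨ρ, hρ⟩ => ?_)
    rintro _ ⟨f, -, rfl⟩
    obtain ⟨t, rfl⟩ := hs.bijective.2 ρ
    exact hK t f (by rw [MvPolynomial.restrictSupport_univ]; trivial)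
  exact ⟨hle.trans h4, fun h => hle.trans (h3 h)⟩

/-- Elements `V t` of square zero that satisfy the relations of the `v_t` define an algebra map on
`R(γ)`, with `v_t ↦ V t` and `u_t ↦ -V (t + 1)`, that vanishes on `I(γ)`; the dimension of `Q(γ)` is
at least that of the image of the sums of members of `W`. -/
theorem le_finrank_vertex [Finite (Face X)] (hs : IsVertexStar γ σ τ) (hΦ : IsCompatible Φ)
    (hg : IsGluedBy Φ γ σ τ a fun _ => -1) (W : Submodule ℝ Poly) [FiniteDimensional ℝ W]
    {A : Type*} [CommRing A] [Algebra ℝ A] (V : ZMod s → A) (hV : ∀ t, V t * V t = 0)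
    (hrec : ∀ t, V t = -V (t + 1 + 1) + V (t + 1) * Polynomial.aeval (-V (t + 1 + 1)) (a t))
    (B : Submodule ℝ A)
    (hB : B ≤ ⨆ t, W.map (MvPolynomial.aeval (R := ℝ) ![-V (t + 1), V t]).toLinearMap) :
    Module.finrank ℝ B ≤ Module.finrank ℝ (QSpace W (vertIdeal Φ γ)) := by
  let Θ : RingAt (vert γ) →ₐ[ℝ] A := MvPolynomial.aeval fun x =>
    ![-V (hs.faceEquiv.symm x.1.1 + 1), V (hs.faceEquiv.symm x.1.1)] x.2
  have hidx : ∀ t, hs.faceEquiv.symm (σ t) = t := fun t => hs.faceEquiv.symm_apply_apply t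
  have hincl : ∀ t, Θ.comp (incl (hs.vert_subset t)) =
      MvPolynomial.aeval ![-V (t + 1), V t] := fun t => MvPolynomial.algHom_ext fun i => by
    simp [Θ, incl, hidx]
  have hker : ∀ x ∈ vertIdeal Φ γ, Θ.toLinearMap x = 0 := by
    suffices h : vertIdeal Φ γ ≤ RingHom.ker Θ from fun x hx => h hx
    rw [hs.vertIdeal_eq]
    refine iSup_le fun t => Ideal.map_le_iff_le_comap.2 fun x hx => ?_
    change Θ (res (hs.mem t) x) = 0
    obtain ⟨Ψ, hΨ, hl, hr⟩ := exists_edgeJet hs hΦ hg t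
    -- `Θ` factors on `R(τ t)` through the jets along `τ t`
    let ρ : DualNumber (Polynomial ℝ) →ₐ[ℝ] A := DualNumber.lift
      ⟨(Polynomial.aeval (-V (t + 1 + 1)), V (t + 1)), hV _, fun _ => Commute.all _ _⟩
    have hinl : ∀ p, ρ (TrivSqZeroExt.inl p) = Polynomial.aeval (-V (t + 1 + 1)) p :=
      fun p => DualNumber.lift_apply_inl _ _
    have heps : ρ DualNumber.eps = V (t + 1) := DualNumber.lift_apply_eps _
    have hfac : ρ.comp Ψ = Θ.comp (res (hs.mem t)) := by
      refine MvPolynomial.algHom_ext fun ⟨⟨κ, hκ⟩, i⟩ => ?_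
      rw [AlgHom.comp_apply, AlgHom.comp_apply]
      rcases hs.eq_or_eq t κ hκ with rfl | rfl
      · have hX : (MvPolynomial.X (⟨σ t, hκ⟩, i) : RingAt (edge (τ t))) =
            incl (hs.subset_left t) (MvPolynomial.X i) := by simp [incl]
        rw [hX, hl, res_incl]
        refine Eq.trans ?_ (DFunLike.congr_fun (hincl t) (MvPolynomial.X i)).symm
        fin_cases i
        · simp [heps]
        · have hinr : (TrivSqZeroExt.inr (a t) : DualNumber (Polynomial ℝ)) =
              TrivSqZeroExt.inl (a t) * DualNumber.eps := by simp [TrivSqZeroExt.ext_iff]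
          change ρ (jetLeft (a t) (MvPolynomial.X 1)) = MvPolynomial.aeval _ (MvPolynomial.X 1)
          rw [jetLeft_X_one, hinr, map_add, map_mul, hinl, hinl, heps, Polynomial.aeval_X,
            MvPolynomial.aeval_X, mul_comm, ← hrec]
          rfl
      · have hX : (MvPolynomial.X (⟨σ (t + 1), hκ⟩, i) : RingAt (edge (τ t))) =
            incl (hs.subset_right t) (MvPolynomial.X i) := by simp [incl]
        rw [hX, hr, res_incl]
        refine Eq.trans ?_ (DFunLike.congr_fun (hincl (t + 1)) (MvPolynomial.X i)).symm
        fin_cases i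
        · simp [hinl]
        · simp [heps]
    have := DFunLike.congr_fun hfac x
    rw [AlgHom.comp_apply, (hΨ x).1 hx, map_zero] at this
    exact this.symm
  refine le_trans ?_ (LinearMap.finrank_range_le (QSpace.lift W _ Θ.toLinearMap hker))
  refine Submodule.finrank_mono (hB.trans (iSup_le fun t => ?_))
  rw [QSpace.range_lift, ← hincl t]
  exact le_iSup (fun ρ : FacesAt (vert γ) => W.map (Θ.toLinearMap ∘ₗ (incl ρ.2).toLinearMap))
    ⟨σ t, hs.vert_subset t⟩

theorem aeval_mul_of_mul_eq_zero {A : Type*} [CommRing A] [Algebra ℝ A] (p : Polynomial ℝ)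
    {x y : A} (h : x * y = 0) : Polynomial.aeval x p * y = p.coeff 0 • y := by
  conv_lhs => rw [← p.divX_mul_X_add]
  rw [map_add, map_mul, Polynomial.aeval_X, Polynomial.aeval_C, add_mul, mul_assoc, h, mul_zero,
    zero_add, Algebra.smul_def]

/-- With `v_t` sent to `ε ζ ^ t` for `ζ = exp (2πi/s)`, the relation `v_t = u_{t+1} + c v_{t+1}`
becomes `1 + ζ² = 2 cos (2π/s) ζ`, and the image contains `1`, `ε` and `ε ζ`. -/
theorem le_finrank_vertex_of_constantCoeff [Finite (Face X)] [NeZero s]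
    (hs : IsVertexStar γ σ τ) (hΦ : IsCompatible Φ)
    (hg : IsGluedBy Φ γ σ τ a fun _ => -1)
    (hc : ∀ t, (a t).coeff 0 = 2 * Real.cos (2 * Real.pi / s))
    (W : Submodule ℝ Poly) [FiniteDimensional ℝ W] (h1 : 1 ∈ W) (hv : MvPolynomial.X 1 ∈ W) :
    3 ≤ Module.finrank ℝ (QSpace W (vertIdeal Φ γ)) := by
  set θ : ℝ := 2 * Real.pi / s with hθ
  let z : ZMod s → ℂ := fun t => (ZMod.toCircle t : ℂ)
  have hz0 : z 0 = 1 := by simp [z]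
  have hzadd : ∀ t t', z (t + t') = z t * z t' := fun t t' => by simp [z, AddChar.map_add_eq_mul]
  have hz1 : z 1 = Real.cos θ + Real.sin θ * Complex.I := by
    have h := ZMod.toCircle_natCast (N := s) 1
    have harg : 2 * (Real.pi : ℂ) * Complex.I * ((1 : ℕ) : ℂ) / (s : ℂ) = (θ : ℂ) * Complex.I := by
      rw [hθ]; push_cast; ring
    rw [harg, Complex.exp_mul_I, ← Complex.ofReal_cos, ← Complex.ofReal_sin] at h
    simpa [z] using h
  have hre : (z 1).re = Real.cos θ := by
    rw [hz1, Complex.add_re, Complex.ofReal_re, Complex.re_ofReal_mul, Complex.I_re, mul_zero,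
      add_zero]
  have him : (z 1).im = Real.sin θ := by
    rw [hz1, Complex.add_im, Complex.ofReal_im, Complex.im_ofReal_mul, Complex.I_im, mul_one,
      zero_add]
  have hsin : Real.sin θ ≠ 0 := by
    have h3 : (3 : ℝ) ≤ s := by exact_mod_cast hs.three_le
    have hpi := Real.pi_pos
    refine (Real.sin_pos_of_pos_of_lt_pi (by positivity) ?_).ne'
    rw [hθ, div_lt_iff₀ (by positivity)]
    nlinarith
  have hquad : 1 + z 1 * z 1 = ((2 * Real.cos θ : ℝ) : ℂ) * z 1 := by
    have h2 : ((Real.sin θ : ℝ) : ℂ) ^ 2 + ((Real.cos θ : ℝ) : ℂ) ^ 2 = 1 := by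
      exact_mod_cast Real.sin_sq_add_cos_sq θ
    rw [hz1, Complex.ofReal_mul, Complex.ofReal_ofNat]
    linear_combination ((Real.sin θ : ℝ) : ℂ) ^ 2 * Complex.I_sq - h2
  let V : ZMod s → TrivSqZeroExt ℝ ℂ := fun t => TrivSqZeroExt.inr (z t)
  have hVV : ∀ t t', V t * V t' = 0 := fun t t' => TrivSqZeroExt.inr_mul_inr _ _ _
  have h3 : Module.finrank ℝ (⊤ : Submodule ℝ (TrivSqZeroExt ℝ ℂ)) = 3 := by
    rw [finrank_top]
    change Module.finrank ℝ (ℝ × ℂ) = 3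
    rw [Module.finrank_prod, Module.finrank_self, Complex.finrank_real_complex]
  rw [← h3]
  refine le_finrank_vertex hs hΦ hg W V (fun t => hVV t t) (fun t => ?_) ⊤ ?_
  · have h0 : -V (t + 1 + 1) * V (t + 1) = 0 := by rw [neg_mul, hVV, neg_zero]
    rw [mul_comm, aeval_mul_of_mul_eq_zero _ h0, hc]
    change TrivSqZeroExt.inr (z t) = -TrivSqZeroExt.inr (z (t + 1 + 1)) +
      (2 * Real.cos θ) • TrivSqZeroExt.inr (z (t + 1))
    rw [← TrivSqZeroExt.inr_neg, ← TrivSqZeroExt.inr_smul, ← TrivSqZeroExt.inr_add]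
    congr 1
    rw [hzadd, hzadd, Complex.real_smul]
    linear_combination z t * hquad
  · rintro x -
    have hmem : ∀ t, ∀ f ∈ W, MvPolynomial.aeval (R := ℝ) ![-V (t + 1), V t] f ∈
        ⨆ t, W.map (MvPolynomial.aeval (R := ℝ) ![-V (t + 1), V t]).toLinearMap :=
      fun t f hf => Submodule.mem_iSup_of_mem t ⟨f, hf, rfl⟩
    have hm1 := hmem 0 1 h1
    have hmv : ∀ t, V t ∈
        ⨆ t, W.map (MvPolynomial.aeval (R := ℝ) ![-V (t + 1), V t]).toLinearMap := fun t => by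
      simpa using hmem t _ hv
    rw [map_one] at hm1
    obtain ⟨β, hβ⟩ : ∃ β : ℝ, β * Real.sin θ = x.snd.im :=
      ⟨x.snd.im / Real.sin θ, div_mul_cancel₀ _ hsin⟩
    obtain ⟨α, hα⟩ : ∃ α : ℝ, α + β * Real.cos θ = x.snd.re :=
      ⟨x.snd.re - β * Real.cos θ, sub_add_cancel _ _⟩
    have hx : x = x.fst • (1 : TrivSqZeroExt ℝ ℂ) + (α • V 0 + β • V 1) := by
      refine TrivSqZeroExt.ext (by simp [V]) ?_
      apply Complex.ext
      · simp [V, hz0, hre, hα]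
      · simp [V, hz0, him, hβ]
    rw [hx]
    exact Submodule.add_mem _ (Submodule.smul_mem _ _ hm1)
      (Submodule.add_mem _ (Submodule.smul_mem _ _ (hmv 0)) (Submodule.smul_mem _ _ (hmv 1)))

/-- In valence four the `v_t` are sent to `x, y, -x, -y` in `ℝ[x, y] / (x², y²)`; this ring is
encoded as the dual numbers over the dual numbers. -/
theorem le_finrank_vertex_four [Finite (Face X)] {σ : ZMod 4 → Face X} {τ : ZMod 4 → Edge X}
    {a : ZMod 4 → Polynomial ℝ} (hs : IsVertexStar γ σ τ) (hΦ : IsCompatible Φ)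
    (hg : IsGluedBy Φ γ σ τ a fun _ => -1)
    (ha : ∀ t, ∃ k : ℝ, a t = Polynomial.C k * Polynomial.X ^ 2)
    (W : Submodule ℝ Poly) [FiniteDimensional ℝ W] (h1 : 1 ∈ W) (hv : MvPolynomial.X 1 ∈ W)
    (huv : MvPolynomial.X 0 * MvPolynomial.X 1 ∈ W) :
    4 ≤ Module.finrank ℝ (QSpace W (vertIdeal Φ γ)) := by
  let x : DualNumber (DualNumber ℝ) := TrivSqZeroExt.inl DualNumber.eps
  let y : DualNumber (DualNumber ℝ) := DualNumber.eps
  have hx : x * x = 0 := by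
    rw [← TrivSqZeroExt.inl_mul, DualNumber.eps_mul_eps, TrivSqZeroExt.inl_zero]
  have hy : y * y = 0 := DualNumber.eps_mul_eps
  let V : ZMod 4 → DualNumber (DualNumber ℝ) := ![x, y, -x, -y]
  have hV : ∀ t, V t * V t = 0 := by
    intro t
    fin_cases t
    · exact hx
    · exact hy
    · exact (neg_mul_neg x x).trans hx
    · exact (neg_mul_neg y y).trans hy
  have hV2 : ∀ t, V t = -V (t + 1 + 1) := by
    intro t
    fin_cases t
    · exact (neg_neg x).symm
    · exact (neg_neg y).symm
    · rfl
    · rfl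
  have h4 : Module.finrank ℝ (⊤ : Submodule ℝ (DualNumber (DualNumber ℝ))) = 4 := by
    rw [finrank_top]
    change Module.finrank ℝ ((ℝ × ℝ) × (ℝ × ℝ)) = 4
    simp
  rw [← h4]
  refine le_finrank_vertex hs hΦ hg W V hV (fun t => ?_) ⊤ ?_
  · obtain ⟨k, hk⟩ := ha t
    rw [hk, map_mul, map_pow, Polynomial.aeval_X, neg_sq, pow_two, hV, mul_zero, mul_zero,
      add_zero]
    exact hV2 t
  · rintro w -
    have hmem : ∀ t, ∀ f ∈ W, MvPolynomial.aeval (R := ℝ) ![-V (t + 1), V t] f ∈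
        ⨆ t, W.map (MvPolynomial.aeval (R := ℝ) ![-V (t + 1), V t]).toLinearMap :=
      fun t f hf => Submodule.mem_iSup_of_mem t ⟨f, hf, rfl⟩
    have hm1 := hmem 0 1 h1
    rw [map_one] at hm1
    have hmx : x ∈ ⨆ t, W.map (MvPolynomial.aeval (R := ℝ) ![-V (t + 1), V t]).toLinearMap := by
      have h := hmem 0 _ hv
      rw [MvPolynomial.aeval_X] at h
      exact h
    have hmy : y ∈ ⨆ t, W.map (MvPolynomial.aeval (R := ℝ) ![-V (t + 1), V t]).toLinearMap := by
      have h := hmem 1 _ hv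
      rw [MvPolynomial.aeval_X] at h
      exact h
    have hmxy : -y * x ∈
        ⨆ t, W.map (MvPolynomial.aeval (R := ℝ) ![-V (t + 1), V t]).toLinearMap := by
      have h := hmem 0 _ huv
      rw [map_mul, MvPolynomial.aeval_X, MvPolynomial.aeval_X] at h
      exact h
    have hw : w = w.fst.fst • (1 : DualNumber (DualNumber ℝ)) + w.fst.snd • x +
        w.snd.fst • y + (-w.snd.snd) • (-y * x) := by
      refine TrivSqZeroExt.ext (TrivSqZeroExt.ext ?_ ?_) (TrivSqZeroExt.ext ?_ ?_) <;>
        simp [x, y]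
    rw [hw]
    exact Submodule.add_mem _ (Submodule.add_mem _ (Submodule.add_mem _
      (Submodule.smul_mem _ _ hm1) (Submodule.smul_mem _ _ hmx)) (Submodule.smul_mem _ _ hmy))
      (Submodule.smul_mem _ _ hmxy)

end VertexDimension

/-! ### Dimensions of the polynomial spaces -/

section Exponents

theorem totalDeg_eq (d : ℕ) : totalDeg d = MvPolynomial.restrictSupport ℝ (totalExponents d) := rfl

theorem biDeg_eq (d : ℕ) : biDeg d = MvPolynomial.restrictSupport ℝ (biExponents d) := rfl

/-- The pair `(i, j)` as an exponent. -/
def pairExponent (p : ℕ × ℕ) : Fin 2 →₀ ℕ := Finsupp.single 0 p.1 + Finsupp.single 1 p.2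

theorem pairExponent_zero (p : ℕ × ℕ) : pairExponent p 0 = p.1 := by simp [pairExponent]

theorem pairExponent_one (p : ℕ × ℕ) : pairExponent p 1 = p.2 := by simp [pairExponent]

theorem pairExponent_injective : Function.Injective pairExponent := fun p q h => by
  have h0 := DFunLike.congr_fun h 0
  have h1 := DFunLike.congr_fun h 1
  rw [pairExponent_zero, pairExponent_zero] at h0
  rw [pairExponent_one, pairExponent_one] at h1
  exact Prod.ext h0 h1

theorem eq_pairExponent (m : Fin 2 →₀ ℕ) : m = pairExponent (m 0, m 1) := by
  ext i
  fin_cases i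
  · exact (pairExponent_zero (m 0, m 1)).symm
  · exact (pairExponent_one (m 0, m 1)).symm

theorem totalExponents_eq (d : ℕ) : totalExponents d =
    pairExponent '' ((Finset.range (d + 1)).biUnion
      Finset.HasAntidiagonal.antidiagonal : Finset (ℕ × ℕ)) := by
  ext m
  have h : (m.sum fun _ e => e) = m 0 + m 1 := by
    rw [Finsupp.sum_fintype _ _ (by simp), Fin.sum_univ_two]
  change (m.sum fun _ e => e) ≤ d ↔ _
  rw [h]
  constructor
  · intro hm
    refine ⟨(m 0, m 1), ?_, (eq_pairExponent m).symm⟩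
    simp
    omega
  · rintro ⟨p, hp, rfl⟩
    rw [pairExponent_zero, pairExponent_one]
    simp at hp
    omega

theorem biExponents_eq (d : ℕ) : biExponents d =
    pairExponent '' (Finset.range (d + 1) ×ˢ Finset.range (d + 1) : Finset (ℕ × ℕ)) := by
  ext m
  change (∀ i, m i ≤ d) ↔ _
  rw [Fin.forall_fin_two]
  constructor
  · intro hm
    refine ⟨(m 0, m 1), ?_, (eq_pairExponent m).symm⟩
    simp
    omega
  · rintro ⟨p, hp, rfl⟩
    rw [pairExponent_zero, pairExponent_one]
    simp at hp
    omega

theorem finite_totalExponents (d : ℕ) : (totalExponents d).Finite := by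
  rw [totalExponents_eq]
  exact (Finset.finite_toSet _).image _

theorem finite_biExponents (d : ℕ) : (biExponents d).Finite := by
  rw [biExponents_eq]
  exact (Finset.finite_toSet _).image _

theorem finiteDimensional_restrictSupport {N : Set (Fin 2 →₀ ℕ)} (hN : N.Finite) :
    FiniteDimensional ℝ (MvPolynomial.restrictSupport ℝ N) := by
  have := hN.to_subtype
  exact Module.Finite.of_basis (MvPolynomial.basisRestrictSupport ℝ N)

instance (d : ℕ) : FiniteDimensional ℝ (totalDeg d) :=
  finiteDimensional_restrictSupport (finite_totalExponents d)

instance (d : ℕ) : FiniteDimensional ℝ (biDeg d) :=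
  finiteDimensional_restrictSupport (finite_biExponents d)

theorem finrank_restrictSupport (N : Set (Fin 2 →₀ ℕ)) :
    Module.finrank ℝ (MvPolynomial.restrictSupport ℝ N) = N.ncard :=
  Module.finrank_eq_nat_card_basis (MvPolynomial.basisRestrictSupport ℝ N)

theorem finrank_totalDeg (d : ℕ) : Module.finrank ℝ (totalDeg d) = (d + 2).choose 2 := by
  rw [totalDeg_eq, finrank_restrictSupport, totalExponents_eq,
    Set.ncard_image_of_injective _ pairExponent_injective, Set.ncard_coe_finset,
    Finset.card_biUnion]
  · simp only [Finset.Nat.card_antidiagonal]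
    induction d with
    | zero => rfl
    | succ d ih =>
      rw [Finset.sum_range_succ, ih, Nat.choose_succ_succ (d + 2) 1, Nat.choose_one_right]
      ring
  · intro i _ j _ hij
    refine Finset.disjoint_left.2 fun p hi hj => hij ?_
    rw [Finset.HasAntidiagonal.mem_antidiagonal] at hi hj
    exact hi.symm.trans hj

theorem choose_two_mul_two (d : ℕ) : (((d + 2).choose 2 : ℕ) : ℤ) * 2 = (d + 2) * (d + 1) := by
  induction d with
  | zero => rfl
  | succ d ih =>
    rw [Nat.choose_succ_succ (d + 2) 1, Nat.choose_one_right]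
    push_cast
    linear_combination ih

theorem finrank_biDeg (d : ℕ) : Module.finrank ℝ (biDeg d) = (d + 1) ^ 2 := by
  rw [biDeg_eq, finrank_restrictSupport, biExponents_eq,
    Set.ncard_image_of_injective _ pairExponent_injective, Set.ncard_coe_finset,
    Finset.card_product, Finset.card_range]
  ring

end Exponents

/-! ### The gluing polynomials -/

section Gluing

theorem symGluing_coeff_zero (w w' : ℕ) {h q : Polynomial ℝ} (h0 : h.eval 0 = 1)
    (q0 : q.eval 0 = 0) :
    (symGluing w w' h q).coeff 0 = 2 * Real.cos (2 * Real.pi / w) := by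
  rw [Polynomial.coeff_zero_eq_eval_zero, symGluing]
  simp [h0, q0]

theorem two_mul_cos_ne_zero {s : ℕ} (h3 : 3 ≤ s) (h4 : s ≠ 4) :
    2 * Real.cos (2 * Real.pi / s) ≠ 0 := by
  have hpi := Real.pi_pos
  refine mul_ne_zero two_ne_zero ?_
  rcases Nat.lt_or_ge s 5 with h | h
  · obtain rfl : s = 3 := by omega
    refine (Real.cos_neg_of_pi_div_two_lt_of_lt ?_ ?_).ne <;> push_cast <;> linarith
  · have h5 : (5 : ℝ) ≤ s := by exact_mod_cast h
    have hpos : (0 : ℝ) < s := by linarith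
    refine (Real.cos_pos_of_mem_Ioo ⟨?_, ?_⟩).ne'
    · have : 0 < 2 * Real.pi / s := by positivity
      linarith
    · rw [div_lt_iff₀ hpos]
      nlinarith

theorem cos_two_pi_div_four : Real.cos (2 * Real.pi / (4 : ℕ)) = 0 := by
  rw [← Real.cos_pi_div_two]
  congr 1
  push_cast
  ring

theorem natDegree_symGluing_le (w w' : ℕ) :
    (symGluing w w' ((1 - Polynomial.X) ^ 2) (Polynomial.X ^ 2)).natDegree ≤ 2 := by
  rw [symGluing]
  compute_degree

theorem symGluing_coeff_one (w w' : ℕ) :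
    (symGluing w w' ((1 - Polynomial.X) ^ 2) (Polynomial.X ^ 2)).coeff 1 =
      -2 * (2 * Real.cos (2 * Real.pi / w)) := by
  have h : (1 - Polynomial.X : Polynomial ℝ) ^ 2 =
      Polynomial.C 1 - Polynomial.C 2 * Polynomial.X + Polynomial.X ^ 2 := by
    simp only [map_one, Polynomial.C_ofNat]
    ring
  rw [symGluing, h, Polynomial.coeff_sub, Polynomial.coeff_C_mul, Polynomial.coeff_C_mul,
    Polynomial.coeff_add, Polynomial.coeff_sub, Polynomial.coeff_C_mul, Polynomial.coeff_C,
    Polynomial.coeff_X_one, Polynomial.coeff_X_pow, if_neg one_ne_zero, if_neg (by norm_num)]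
  ring

theorem symGluing_four (w' : ℕ) (h : Polynomial ℝ) :
    symGluing 4 w' h (Polynomial.X ^ 2) =
      Polynomial.C (-(2 * Real.cos (2 * Real.pi / w'))) * Polynomial.X ^ 2 := by
  rw [symGluing, cos_two_pi_div_four]
  simp

end Gluing

/-! ### Symmetric gluing data -/

section SymmetricStar

variable {X : Type*} [TopologicalSpace X] [CWComplex (Set.univ : Set X)]
  [Fintype (Face X)] {γ : Vertex X} {s : ℕ} {σ : ZMod s → Face X} {τ : ZMod s → Edge X}
  {ψ : Face X → X → Fin 2 → ℝ} {Φ : Transitions ψ 1} {a : ZMod s → Polynomial ℝ}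

/-- The bounds of `exists_finrank_le` for the cokernel of `δ₂`. -/
theorem finrank_cokernel_le [Fintype (Vertex X)] [Fintype (Edge X)]
    [NeZero s] (hs : IsVertexStar γ σ τ) (o : CellOrientation X)
    (hΦ : IsCompatible Φ) (hg : IsGluedBy Φ γ σ τ a fun _ => -1) {c : ℝ}
    (hc : ∀ t, (a t).coeff 0 = c) {N : Set (Fin 2 →₀ ℕ)}
    (hW : ∀ t, IsAmple (MvPolynomial.restrictSupport ℝ N) (a t)) :
    Module.finrank ℝ (Chain₁ Φ (MvPolynomial.restrictSupport ℝ N) ⧸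
        LinearMap.range (δ₂ o Φ (MvPolynomial.restrictSupport ℝ N))) ≤ 4 ∧
      (c ≠ 0 → Module.finrank ℝ (Chain₁ Φ (MvPolynomial.restrictSupport ℝ N) ⧸
        LinearMap.range (δ₂ o Φ (MvPolynomial.restrictSupport ℝ N))) ≤ 3) := by
  obtain ⟨F, htop, hF⟩ := exists_cokernel_maps hs o Φ (MvPolynomial.restrictSupport ℝ N)
  choose G hG using fun t => LinearMap.exists_extend (F t)
  have hGF : ∀ t (f : MvPolynomial.restrictSupport ℝ N), G t f = F t f :=
    fun t f => DFunLike.congr_fun (hG t) f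
  obtain ⟨K, hfin, h4, h3, hK⟩ := exists_finrank_le (F := G) hc hW (fun t f hf g hg' h => by
    refine (hGF t ⟨f, hf⟩).trans (Eq.trans ?_ (hGF (t + 1) ⟨g, hg'⟩).symm)
    refine hF t _ _ ((QSpace.faceMap_eq_iff _ _ _ _ _ _).2 ?_)
    exact incl_sub_incl_mem_edgeIdeal hs hΦ hg t f g h)
  have hKtop : K = ⊤ := by
    rw [eq_top_iff, ← htop]
    refine iSup_le fun t => ?_
    rintro _ ⟨f, rfl⟩
    rw [← hGF]
    exact hK t f f.2
  rw [hKtop, finrank_top] at h4 h3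
  exact ⟨h4, h3⟩

theorem IsWindow.mem_support {N : Set (Fin 2 →₀ ℕ)} {d n : ℕ} (hN : IsWindow N d n)
    (hd : 1 ≤ d) (hn : 2 ≤ n) :
    (1 : Poly) ∈ MvPolynomial.restrictSupport ℝ N ∧
    (MvPolynomial.X 1 : Poly) ∈ MvPolynomial.restrictSupport ℝ N ∧
    (MvPolynomial.X 0 * MvPolynomial.X 1 : Poly) ∈ MvPolynomial.restrictSupport ℝ N := by
  exact ⟨by simpa using monomial_mem_of_mem (hN.row_zero_mem 0 (by omega)),
    by simpa using monomial_mem_of_mem (hN.column_zero_mem 1 hd),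
    by simpa using monomial_mem_of_mem (hN.row_one_mem 1 hn)⟩

theorem finrank_vertex_eq_three [NeZero s] (hs : IsVertexStar γ σ τ) (hΦ : IsCompatible Φ)
    (hg : IsGluedBy Φ γ σ τ a fun _ => -1)
    (hc : ∀ t, (a t).coeff 0 = 2 * Real.cos (2 * Real.pi / s)) (h4 : s ≠ 4)
    {N : Set (Fin 2 →₀ ℕ)} (hfin : N.Finite) {d n : ℕ} (hN : IsWindow N d n) (hd : 1 ≤ d)
    (hn : 2 ≤ n) :
    Module.finrank ℝ (QSpace (MvPolynomial.restrictSupport ℝ N) (vertIdeal Φ γ)) = 3 := by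
  have := finiteDimensional_restrictSupport hfin
  obtain ⟨h1, hv, -⟩ := hN.mem_support hd hn
  exact le_antisymm ((finrank_vertex_le hs hΦ hg hc _).2 (two_mul_cos_ne_zero hs.three_le h4))
    (le_finrank_vertex_of_constantCoeff hs hΦ hg hc _ h1 hv)

/-- The Euler characteristic away from valence four, if all gluing polynomials have the same
degree. -/
theorem eulerChar_of_ne_four [Fintype (Vertex X)] [Fintype (Edge X)]
    [NeZero s] (hs : IsVertexStar γ σ τ) (hΦ : IsCompatible Φ)
    (hg : IsGluedBy Φ γ σ τ a fun _ => -1)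
    (hc : ∀ t, (a t).coeff 0 = 2 * Real.cos (2 * Real.pi / s)) (h4 : s ≠ 4) {k : ℕ}
    (hk : ∀ t, (a t).natDegree = k) {N : Set (Fin 2 →₀ ℕ)} (hfin : N.Finite) {d n : ℕ}
    (hN : IsWindow N d n) (hd : 1 ≤ d) (hn : 2 ≤ n) (hkn : k ≤ n) (hnk : n ≤ d + k) :
    eulerChar Φ (MvPolynomial.restrictSupport ℝ N) =
      s * (Module.finrank ℝ (MvPolynomial.restrictSupport ℝ N) : ℤ) - s * (2 * d + k + 1) + 3 := by
  have := finiteDimensional_restrictSupport hfin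
  have hedge : ∀ t, Module.finrank ℝ (QSpace (MvPolynomial.restrictSupport ℝ N)
      (edgeIdeal Φ (τ t))) = 2 * d + k + 1 := fun t => by
    have h0 : a t ≠ 0 := fun h => two_mul_cos_ne_zero hs.three_le h4 (by
      rw [← hc t, h, Polynomial.coeff_zero])
    rw [finrank_edge_of_ne_zero hs hΦ hg hN t h0 (by rw [hk]; exact hkn) (by rw [hk]; exact hnk),
      hk]
  rw [hs.eulerChar_eq, finrank_vertex_eq_three hs hΦ hg hc h4 hfin hN hd hn]
  simp only [hedge, Finset.sum_const, Finset.card_univ, ZMod.card, nsmul_eq_mul]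
  push_cast
  ring

theorem finrank_vertex_eq_four (hs : IsVertexStar γ σ τ) (hΦ : IsCompatible Φ)
    (hg : IsGluedBy Φ γ σ τ a fun _ => -1) (h4 : s = 4)
    (ha : ∀ t, ∃ k : ℝ, a t = Polynomial.C k * Polynomial.X ^ 2)
    {N : Set (Fin 2 →₀ ℕ)} (hfin : N.Finite) {d n : ℕ} (hN : IsWindow N d n) (hd : 1 ≤ d)
    (hn : 2 ≤ n) :
    Module.finrank ℝ (QSpace (MvPolynomial.restrictSupport ℝ N) (vertIdeal Φ γ)) = 4 := by
  subst h4
  have := finiteDimensional_restrictSupport hfin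
  obtain ⟨h1, hv, huv⟩ := hN.mem_support hd hn
  have hc : ∀ t, (a t).coeff 0 = 0 := fun t => by
    obtain ⟨k, hk⟩ := ha t
    simp [hk]
  exact le_antisymm (finrank_vertex_le hs hΦ hg hc _).1
    (le_finrank_vertex_four hs hΦ hg ha _ h1 hv huv)

/-- The Euler characteristic in valence four, in terms of the common dimension of the spaces
`Q(τ t)`. -/
theorem eulerChar_of_four [Fintype (Vertex X)] [Fintype (Edge X)]
    (hs : IsVertexStar γ σ τ) (hΦ : IsCompatible Φ)
    (hg : IsGluedBy Φ γ σ τ a fun _ => -1) (h4 : s = 4)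
    (ha : ∀ t, ∃ k : ℝ, a t = Polynomial.C k * Polynomial.X ^ 2)
    {N : Set (Fin 2 →₀ ℕ)} (hfin : N.Finite) {d n : ℕ} (hN : IsWindow N d n) (hd : 1 ≤ d)
    (hn : 2 ≤ n) {D : ℕ} (hD : ∀ t, Module.finrank ℝ
      (QSpace (MvPolynomial.restrictSupport ℝ N) (edgeIdeal Φ (τ t))) = D) :
    eulerChar Φ (MvPolynomial.restrictSupport ℝ N) =
      4 * (Module.finrank ℝ (MvPolynomial.restrictSupport ℝ N) : ℤ) - 4 * D + 4 := by
  have := hs.neZero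
  have := finiteDimensional_restrictSupport hfin
  rw [hs.eulerChar_eq, finrank_vertex_eq_four hs hΦ hg h4 ha hfin hN hd hn]
  simp only [hD, Finset.sum_const, Finset.card_univ, ZMod.card, nsmul_eq_mul, h4]
  push_cast
  ring

/-- For the standard gluing data `H₁` vanishes if the degree is high enough to carry `v²` across
an edge: its image involves `u ^ 3 v`. -/
theorem finrank_splines_of_standard [Fintype (Vertex X)] [Fintype (Edge X)]
    (hs : IsVertexStar γ σ τ) (o : CellOrientation X)
    (hΦ : IsCompatible Φ) (w : ZMod s → ℕ)
    (hg : IsGluedBy Φ γ σ τ (fun t => symGluing s (w t) ((1 - Polynomial.X) ^ 2)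
      (Polynomial.X ^ 2)) fun _ => -1)
    {N : Set (Fin 2 →₀ ℕ)} (hfin : N.Finite) {d n : ℕ} (hN : IsWindow N d n) (hd : 2 ≤ d)
    (hn : 4 ≤ n) :
    (Module.finrank ℝ (splines Φ (MvPolynomial.restrictSupport ℝ N)) : ℤ) =
      eulerChar Φ (MvPolynomial.restrictSupport ℝ N) := by
  have := hs.neZero
  have := finiteDimensional_restrictSupport hfin
  have hc : ∀ t, (symGluing s (w t) ((1 - Polynomial.X) ^ 2) (Polynomial.X ^ 2)).coeff 0 =
      2 * Real.cos (2 * Real.pi / s) := fun t => symGluing_coeff_zero _ _ (by simp) (by simp)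
  have hle := finrank_cokernel_le hs o hΦ hg hc
    fun t => hN.isAmple hd hn (natDegree_symGluing_le s (w t))
  apply finrank_splines_eq_eulerChar hs o hΦ
  by_cases h4 : s = 4
  · rw [finrank_vertex_eq_four hs hΦ hg h4
      (fun t => ⟨_, by rw [h4]; exact symGluing_four _ _⟩) hfin hN (by omega) (by omega)]
    exact hle.1
  · rw [finrank_vertex_eq_three hs hΦ hg hc h4 hfin hN (by omega) (by omega)]
    exact hle.2 (two_mul_cos_ne_zero hs.three_le h4)

end SymmetricStar

end GrSpline

end

theorem mainTheorem2 {X : Type*} [TopologicalSpace X] [Topology.CWComplex (Set.univ : Set X)]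
    [Fintype (GrSpline.Vertex X)] [Fintype (GrSpline.Edge X)] [Fintype (GrSpline.Face X)]
    (o : GrSpline.CellOrientation X) (r : ℕ) (ψ : GrSpline.Face X → X → Fin 2 → ℝ)
    (Φ : GrSpline.Transitions ψ r) (hΦ : GrSpline.IsGrDomain Φ)
    (γ : GrSpline.Vertex X) (s : ℕ) (σ : ZMod s → GrSpline.Face X) (τ : ZMod s → GrSpline.Edge X)
    (hstar : GrSpline.IsVertexStar γ σ τ) :
    -- arbitrary `r`, total degree and bidegree
    (∀ d : ℕ,
      (Module.finrank ℝ (GrSpline.splines Φ (GrSpline.totalDeg d)) : ℤ) =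
        GrSpline.eulerChar Φ (GrSpline.totalDeg d)
          + Module.finrank ℝ (GrSpline.H₁ o Φ (GrSpline.totalDeg d)) ∧
      GrSpline.eulerChar Φ (GrSpline.totalDeg d) ≤
        Module.finrank ℝ (GrSpline.splines Φ (GrSpline.totalDeg d)) ∧
      (Module.finrank ℝ (GrSpline.splines Φ (GrSpline.biDeg d)) : ℤ) =
        GrSpline.eulerChar Φ (GrSpline.biDeg d)
          + Module.finrank ℝ (GrSpline.H₁ o Φ (GrSpline.biDeg d)) ∧
      GrSpline.eulerChar Φ (GrSpline.biDeg d) ≤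
        Module.finrank ℝ (GrSpline.splines Φ (GrSpline.biDeg d))) ∧
    -- `r = 1`, symmetric gluing data; `w' t` is the valence of the other vertex of `τ t`
    (r = 1 → ∀ (w' : ZMod s → ℕ), (∀ t, 0 < w' t) → ∀ h q : Polynomial ℝ,
      h.eval 0 = 1 → h.eval 1 = 0 → q.eval 0 = 0 → q.eval 1 = 1 →
      GrSpline.IsGluedBy Φ γ σ τ (fun t => GrSpline.symGluing s (w' t) h q) (fun _ => -1) →
      -- Euler characteristic for `s ≠ 4`
      (s ≠ 4 → ∀ dₐ : ℕ, 1 ≤ dₐ → (∀ t, (GrSpline.symGluing s (w' t) h q).natDegree = dₐ) →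
        ∀ d : ℕ,
          (dₐ + 1 ≤ d → GrSpline.eulerChar Φ (GrSpline.totalDeg d) =
            s * ((d + 2).choose 2 : ℤ) - s * (2 * d + dₐ + 1) + 3) ∧
          (dₐ ≤ d → GrSpline.eulerChar Φ (GrSpline.biDeg d) =
            s * ((d : ℤ) + 1) ^ 2 - s * (2 * d + dₐ + 1) + 3)) ∧
      -- the standard choice `h = (1 - u)²`, `q = u²`
      (h = (1 - Polynomial.X) ^ 2 → q = Polynomial.X ^ 2 →
        (∀ d : ℕ, 4 ≤ d →
          (Module.finrank ℝ (GrSpline.splines Φ (GrSpline.totalDeg d)) : ℤ) =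
            GrSpline.eulerChar Φ (GrSpline.totalDeg d)) ∧
        (∀ d : ℕ, 3 ≤ d →
          (Module.finrank ℝ (GrSpline.splines Φ (GrSpline.biDeg d)) : ℤ) =
            GrSpline.eulerChar Φ (GrSpline.biDeg d)) ∧
        (s ≠ 4 → ∀ t, 1 ≤ (GrSpline.symGluing s (w' t) h q).natDegree) ∧
        (s = 4 → (∀ t, GrSpline.symGluing s (w' t) h q ≠ 0) → ∀ d : ℕ,
          (2 ≤ d → GrSpline.eulerChar Φ (GrSpline.totalDeg d) = 2 * ((d : ℤ) ^ 2 - d - 2)) ∧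
          (1 ≤ d → GrSpline.eulerChar Φ (GrSpline.biDeg d) = 4 * ((d : ℤ) ^ 2 - 1))) ∧
        (s = 4 → (∀ t, GrSpline.symGluing s (w' t) h q = 0) → ∀ d : ℕ,
          (2 ≤ d → GrSpline.eulerChar Φ (GrSpline.totalDeg d) = 2 * ((d : ℤ) ^ 2 - d + 2)) ∧
          (1 ≤ d → GrSpline.eulerChar Φ (GrSpline.biDeg d) = 4 * (d : ℤ) ^ 2)))) := by
  have hcomp := hΦ.isCompatible
  refine ⟨fun d => ?_, ?_⟩
  · have h1 := GrSpline.finrank_splines_eq_add hstar o hcomp (GrSpline.totalDeg d)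
    have h2 := GrSpline.finrank_splines_eq_add hstar o hcomp (GrSpline.biDeg d)
    exact ⟨h1, by omega, h2, by omega⟩
  rintro rfl w' - h q h0 - q0 - hg
  have := hstar.neZero
  have hc : ∀ t, (GrSpline.symGluing s (w' t) h q).coeff 0 = 2 * Real.cos (2 * Real.pi / s) :=
    fun t => GrSpline.symGluing_coeff_zero _ _ h0 q0
  refine ⟨fun h4 k hk1 hk d => ⟨fun hd => ?_, fun hd => ?_⟩, ?_⟩
  · rw [← GrSpline.finrank_totalDeg, GrSpline.totalDeg_eq]
    exact GrSpline.eulerChar_of_ne_four hstar hcomp hg hc h4 hk (GrSpline.finite_totalExponents d)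
      (GrSpline.isWindow_totalDeg d) (by omega) (by omega) (by omega) (by omega)
  · have hdim : ((d : ℤ) + 1) ^ 2 = Module.finrank ℝ (GrSpline.biDeg d) := by
      rw [GrSpline.finrank_biDeg]
      push_cast
      rfl
    rw [hdim, GrSpline.biDeg_eq]
    exact GrSpline.eulerChar_of_ne_four hstar hcomp hg hc h4 hk (GrSpline.finite_biExponents d)
      (GrSpline.isWindow_biDeg (by omega)) (by omega) (by omega) (by omega) (by omega)
  rintro rfl rfl
  have hfour : s = 4 → ∀ t, GrSpline.symGluing s (w' t) ((1 - Polynomial.X) ^ 2)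
      (Polynomial.X ^ 2) = Polynomial.C (-(2 * Real.cos (2 * Real.pi / w' t))) *
        Polynomial.X ^ 2 := fun h4 t => by
    rw [h4]
    exact GrSpline.symGluing_four _ _
  refine ⟨fun d hd => ?_, fun d hd => ?_, fun h4 t => ?_, fun h4 hne d => ?_, fun h4 hz d => ?_⟩
  · exact GrSpline.finrank_splines_of_standard hstar o hcomp w' hg
      (GrSpline.finite_totalExponents d) (GrSpline.isWindow_totalDeg d) (by omega) hd
  · exact GrSpline.finrank_splines_of_standard hstar o hcomp w' hg
      (GrSpline.finite_biExponents d) (GrSpline.isWindow_biDeg (by omega)) (by omega) (by omega)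
  · refine Polynomial.le_natDegree_of_ne_zero ?_
    rw [GrSpline.symGluing_coeff_one]
    exact mul_ne_zero (by norm_num) (GrSpline.two_mul_cos_ne_zero hstar.three_le h4)
  · have hdeg : ∀ t, (GrSpline.symGluing s (w' t) ((1 - Polynomial.X) ^ 2)
        (Polynomial.X ^ 2)).natDegree = 2 := fun t => by
      have h1 := hne t
      rw [hfour h4 t] at h1 ⊢
      exact Polynomial.natDegree_C_mul_X_pow 2 _ fun hz => h1 (by rw [hz]; simp)
    refine ⟨fun hd => ?_, fun hd => ?_⟩
    · have hD := fun t => GrSpline.finrank_edge_of_ne_zero hstar hcomp hg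
        (GrSpline.isWindow_totalDeg d) t (hne t) (by rw [hdeg]; omega) (by rw [hdeg]; omega)
      simp only [hdeg] at hD
      rw [GrSpline.totalDeg_eq, GrSpline.eulerChar_of_four hstar hcomp hg h4
        (fun t => ⟨_, hfour h4 t⟩) (GrSpline.finite_totalExponents d)
        (GrSpline.isWindow_totalDeg d) (by omega) (by omega) hD, ← GrSpline.totalDeg_eq,
        GrSpline.finrank_totalDeg]
      push_cast
      linear_combination 2 * GrSpline.choose_two_mul_two d
    · have hD := fun t => GrSpline.finrank_edge_of_ne_zero hstar hcomp hg
        (GrSpline.isWindow_biDeg hd) t (hne t) (by rw [hdeg]; omega) (by rw [hdeg]; omega)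
      simp only [hdeg] at hD
      rw [GrSpline.biDeg_eq, GrSpline.eulerChar_of_four hstar hcomp hg h4
        (fun t => ⟨_, hfour h4 t⟩) (GrSpline.finite_biExponents d)
        (GrSpline.isWindow_biDeg hd) (by omega) (by omega) hD, ← GrSpline.biDeg_eq,
        GrSpline.finrank_biDeg]
      push_cast
      ring
  · refine ⟨fun hd => ?_, fun hd => ?_⟩
    · have hD := fun t => GrSpline.finrank_edge_of_eq_zero hstar hcomp hg
        (GrSpline.isWindow_totalDeg d) t (hz t)
      rw [GrSpline.totalDeg_eq, GrSpline.eulerChar_of_four hstar hcomp hg h4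
        (fun t => ⟨_, hfour h4 t⟩) (GrSpline.finite_totalExponents d)
        (GrSpline.isWindow_totalDeg d) (by omega) (by omega) hD, ← GrSpline.totalDeg_eq,
        GrSpline.finrank_totalDeg]
      push_cast
      linear_combination 2 * GrSpline.choose_two_mul_two d
    · have hD := fun t => GrSpline.finrank_edge_of_eq_zero hstar hcomp hg
        (GrSpline.isWindow_biDeg hd) t (hz t)
      rw [GrSpline.biDeg_eq, GrSpline.eulerChar_of_four hstar hcomp hg h4
        (fun t => ⟨_, hfour h4 t⟩) (GrSpline.finite_biExponents d)
        (GrSpline.isWindow_biDeg hd) (by omega) (by omega) hD, ← GrSpline.biDeg_eq,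
        GrSpline.finrank_biDeg]
      push_cast
      ring
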